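/- **Setting.** Let $\mathcal X\subset\mathbb R^d$ be compact and let $\mathcal H$ be a reproducing kernel Hilbert space of real functions on $\mathcal X$ with continuous kernel $k$ satisfying $k(x,x)\le 1$. Fix $\lambda>0$, $R\ge 0$, $\delta\in(0,1)$. In round $t=1,\dots,T$ a learner queries $x_t\in\mathcal X$ and observes $y_t=f_t(x_t)+\eta_t$, where $f_t\in\mathcal H$ are fixed unknown functions with $\|f_t\|_{\mathcal H}\le B$ and $\sum_{t=1}^{T-1}\|f_{t+1}-f_t\|_{\mathcal H}\le P_T$, and the noise is conditionally $R$-sub-Gaussian: $\mathbb E[e^{\theta\eta_t}\mid\mathcal F_{t-1}]\le e^{\theta^2R^2/2}$ for all $\theta\in\mathbb R$, with $\mathcal F_{t-1}=\sigma(x_1,y_1,\dots,x_{t-1},y_{t-1},x_t)$. The dynamic regret is $\mathcal R(T)=\sum_{t=1}^T\big(\max_{x\in\mathcal X}f_t(x)-f_t(x_t)\big)$, and the maximum information gain is $\gamma_n=\max_{a_1,\dots,a_n\in\mathcal X}\frac12\ln\det\big(I+\lambda^{-1}[k(a_i,a_j)]_{i,j}\big)$ (points may repeat). **Algorithm.**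 R-GP-UCB with reset interval $H$ discards its data in the rounds $t_0=1,H+1,2H+1,\dots$ (initialising $\mu=\sigma=0$, so that in a reset round any point may be queried), and in every other round it plays a maximiser $x_t\in\arg\max_{x\in\mathcal X}\mu_{t-1}(x)+\beta_t\sigma_{t-1}(x)$, ties broken arbitrarily. Here $\mu_{t-1},\sigma_{t-1}$ are the Gaussian process posterior mean and standard deviation (prior $\mathcal{GP}(0,k)$, noise variance $\lambda$) computed from the data of rounds $t_0,\dots,t-1$ only, $t_0$ being the last reset, and $\beta_t=B+\frac{R}{\sqrt\lambda}\sqrt{2\gamma_{t-t_0}+2\ln(1/\delta)}$; when $\lambda\ge1$ the choice $\beta_t=B+R\sqrt{2(\gamma_{t-t_0}+1+\ln(1/\delta))}$ is allowed as well. **Theorem.** Let $\beta(\delta)=B+\frac{R}{\sqrt\lambda}\sqrt{2\gamma_H+2\ln(1/\delta)}$. (i) There is a constant $C$ depending only on $\lambda$ such that for all integers $1\le H\le T$, with probability at least $1-\delta$, $$\mathcal R(T)\le C\Big(\sqrt{\gamma_H}\,H^{3/2}P_T+\beta(\delta)\,T\sqrt{\gamma_H/H}\Big).$$ (ii) There is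 a constant $C$ depending only on $\lambda$ and $k$ such that for all $T\ge1$: with the reset interval $H=\max\{1,\min\{T,\lceil\gamma_T^{1/4}(T/(1+P_T))^{1/2}\rceil\}\}$ (known $P_T$), with probability at least $1-\delta$, $$\mathcal R(T)\le C\big(1+B+R\sqrt{1+\ln(1/\delta)}\big)\,\gamma_T^{7/8}(1+P_T)^{1/4}T^{3/4};$$ and with $H=\max\{1,\min\{T,\lceil\gamma_T^{1/4}T^{1/2}\rceil\}\}$ (unknown $P_T$), with probability at least $1-\delta$, $$\mathcal R(T)\le C\big(1+B+R\sqrt{1+\ln(1/\delta)}\big)\,\gamma_T^{7/8}(1+P_T)\,T^{3/4}.$$ -/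

import Mathlib

open MeasureTheory Matrix

namespace TVBO

/-- The scalar reproducing kernel `k(x, y)` of a real reproducing kernel Hilbert space `E` of
real-valued functions on `X`. -/
noncomputable def kern {X : Type*} (E : Type*) [NormedAddCommGroup E] [InnerProductSpace ℝ E]
    [CompleteSpace E] [RKHS ℝ E X ℝ] (x y : X) : ℝ :=
  RKHS.kernel E x y 1

/-- The kernel matrix `[k(a_i, a_j)]` of a finite sequence of points. -/
def kernMat {X : Type*} (k : X → X → ℝ) {n : ℕ} (a : Fin n → X) : Matrix (Fin n) (Fin n) ℝ :=
  Matrix.of fun i j => k (a i) (a j)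

/-- The maximum information gain `γ_n`, the maximum of `(1/2) ln det (I + λ⁻¹ K_A)` over all
choices `A` of `n` points. Points may be repeated, as the queries of the algorithm may be. -/
noncomputable def maxInfoGain {X : Type*} (k : X → X → ℝ) (lam : ℝ) (n : ℕ) : ℝ :=
  ⨆ a : Fin n → X, (1 / 2 : ℝ) * Real.log (1 + lam⁻¹ • kernMat k a).det

/-- The vector `[k(a_1, z), …, k(a_n, z)]`. -/
def kernVec {X : Type*} (k : X → X → ℝ) {n : ℕ} (a : Fin n → X) (z : X) : Fin n → ℝ :=
  fun i => k (a i) z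

/-- Gaussian process posterior mean at `z` from observations `v` at the points `a`. -/
noncomputable def postMean {X : Type*} (k : X → X → ℝ) (lam : ℝ) {n : ℕ} (a : Fin n → X)
    (v : Fin n → ℝ) (z : X) : ℝ :=
  kernVec k a z ⬝ᵥ ((kernMat k a + lam • (1 : Matrix (Fin n) (Fin n) ℝ))⁻¹ *ᵥ v)

/-- Gaussian process posterior variance at `z` from observations at the points `a`. -/
noncomputable def postVar {X : Type*} (k : X → X → ℝ) (lam : ℝ) {n : ℕ} (a : Fin n → X)
    (z : X) : ℝ :=
  k z z -
    kernVec k a z ⬝ᵥ ((kernMat k a + lam • (1 : Matrix (Fin n) (Fin n) ℝ))⁻¹ *ᵥ kernVec k a z)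

/-- Gaussian process posterior standard deviation. -/
noncomputable def postStd {X : Type*} (k : X → X → ℝ) (lam : ℝ) {n : ℕ} (a : Fin n → X)
    (z : X) : ℝ :=
  √(postVar k lam a z)

/-- The confidence width `B + (R / √λ) √(2 γ_n + 2 ln(1/δ))`. -/
noncomputable def beta {X : Type*} (k : X → X → ℝ) (lam B R δ : ℝ) (n : ℕ) : ℝ :=
  B + 1 / √lam * R * √(2 * maxInfoGain k lam n + 2 * Real.log (1 / δ))

/-- The variant `B + R √(2 (γ_n + 1 + ln(1/δ)))` of the confidence width, without the factor
`1 / √λ`. -/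
noncomputable def betaPlus {X : Type*} (k : X → X → ℝ) (lam B R δ : ℝ) (n : ℕ) : ℝ :=
  B + R * √(2 * (maxInfoGain k lam n + 1 + Real.log (1 / δ)))

/-- The upper confidence index maximised by R-GP-UCB in round `s`, with reset interval `H` and
exploration coefficients `b`.

Rounds are counted from `0`, so resets happen in the rounds that are multiples of `H`, and
`s % H` is the number of samples collected since the last reset, namely those of the rounds
`s - s % H, …, s - 1`; only these are used. In a reset round the mean and the width are
initialised to `0`, so that the index vanishes and every point is a maximiser. -/
noncomputable def ucbIndex {X : Type*} (k : X → X → ℝ) (lam : ℝ) (b : ℕ → ℝ) (H : ℕ)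
    (x : ℕ → X) (y : ℕ → ℝ) (s : ℕ) (z : X) : ℝ :=
  if s % H = 0 then 0
  else
    postMean k lam (fun i : Fin (s % H) => x (s - s % H + i))
        (fun i : Fin (s % H) => y (s - s % H + i)) z
      + b (s % H) * postStd k lam (fun i : Fin (s % H) => x (s - s % H + i)) z

/-- In each of the `T` rounds the query point maximises the upper confidence index. -/
def SelectsUCB {X : Type*} (k : X → X → ℝ) (lam : ℝ) (b : ℕ → ℝ) (H T : ℕ)
    (x : ℕ → X) (y : ℕ → ℝ) : Prop :=
  ∀ s < T, ∀ z : X, ucbIndex k lam b H x y s z ≤ ucbIndex k lam b H x y s (x s)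

/-- The reward `y_s = f_s(x_s) + η_s`. -/
noncomputable def reward {X E Ω : Type*} [NormedAddCommGroup E] [InnerProductSpace ℝ E]
    [RKHS ℝ E X ℝ] (f : ℕ → E) (x : ℕ → Ω → X) (η : ℕ → Ω → ℝ) (s : ℕ) (ω : Ω) : ℝ :=
  f s (x s ω) + η s ω

/-- The σ-algebra generated by the queries and rewards of the rounds before `s` and by the query
of round `s`. -/
abbrev history {X Ω : Type*} [mX : MeasurableSpace X] (x : ℕ → Ω → X) (y : ℕ → Ω → ℝ) (s : ℕ) :
    MeasurableSpace Ω :=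
  (⨆ τ : Fin s, mX.comap (x τ) ⊔ (borel ℝ).comap (y τ)) ⊔ mX.comap (x s)

/-- The noise of the first `T` rounds is conditionally `R`-sub-Gaussian. -/
def CondSubGaussian {X Ω : Type*} [MeasurableSpace X] [MeasurableSpace Ω] (μ : Measure Ω)
    (x : ℕ → Ω → X) (y η : ℕ → Ω → ℝ) (R : ℝ) (T : ℕ) : Prop :=
  ∀ s < T, ∀ θ : ℝ,
    Integrable (fun ω => Real.exp (θ * η s ω)) μ ∧
      μ[fun ω => Real.exp (θ * η s ω) | history x y s]
        ≤ᵐ[μ] fun _ => Real.exp (θ ^ 2 * R ^ 2 / 2)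

/-- A run of R-GP-UCB with reset interval `H` over `T` rounds in a time-varying environment
`f_0, …, f_{T-1}` of norm at most `B` and variation at most `P`, with conditionally
`R`-sub-Gaussian noise. The exploration coefficients are `beta`, or `betaPlus`; the latter is
a valid confidence width only if `1 ≤ λ`. Ties in the maximisation are broken arbitrarily. -/
structure IsRun {X : Type*} (E : Type*) {Ω : Type*} [MeasurableSpace X] [NormedAddCommGroup E]
    [InnerProductSpace ℝ E] [CompleteSpace E] [RKHS ℝ E X ℝ] [MeasurableSpace Ω]
    (μ : Measure Ω) (f : ℕ → E) (x : ℕ → Ω → X) (η : ℕ → Ω → ℝ)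
    (lam B R P δ : ℝ) (H T : ℕ) : Prop where
  norm_le : ∀ s < T, ‖f s‖ ≤ B
  variation_le : ∑ s ∈ Finset.range (T - 1), ‖f (s + 1) - f s‖ ≤ P
  measurable_query : ∀ s, Measurable (x s)
  measurable_noise : ∀ s, Measurable (η s)
  noise : CondSubGaussian μ x (reward f x η) η R T
  select :
    (∀ ω, SelectsUCB (kern E) lam (beta (kern E) lam B R δ) H T
        (fun s => x s ω) (fun s => reward f x η s ω)) ∨
    (1 ≤ lam ∧ ∀ ω, SelectsUCB (kern E) lam (betaPlus (kern E) lam B R δ) H T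
        (fun s => x s ω) (fun s => reward f x η s ω))

/-- The dynamic regret of the queries `x_0, …, x_{T-1}`. -/
noncomputable def dynRegret {X E : Type*} [NormedAddCommGroup E] [InnerProductSpace ℝ E]
    [RKHS ℝ E X ℝ] (f : ℕ → E) (x : ℕ → X) (T : ℕ) : ℝ :=
  ∑ s ∈ Finset.range T, ((⨆ z : X, f s z) - f s (x s))

/-- The reset interval `γ_T^{1/4} (T / (1 + P))^{1/2}`, rounded up and kept between `1` and `T`,
for a known variation budget `P`. -/
noncomputable def resetKnown {X : Type*} (k : X → X → ℝ) (lam P : ℝ) (T : ℕ) : ℕ :=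
  max 1 (min T ⌈maxInfoGain k lam T ^ (1 / 4 : ℝ) * ((T : ℝ) / (1 + P)) ^ (1 / 2 : ℝ)⌉₊)

/-- The reset interval `γ_T^{1/4} T^{1/2}`, rounded up and kept between `1` and `T`, for an
unknown variation budget. -/
noncomputable def resetUnknown {X : Type*} (k : X → X → ℝ) (lam : ℝ) (T : ℕ) : ℕ :=
  max 1 (min T ⌈maxInfoGain k lam T ^ (1 / 4 : ℝ) * (T : ℝ) ^ (1 / 2 : ℝ)⌉₊)

end TVBO

/-!
The algorithm uses a confidence width with `ln (1/δ)`, not `ln (T/(Hδ))`, so in a long run the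
confidence bounds do fail in some of the blocks between resets, and a union bound over the blocks
is not available. The proof controls the total damage of these failures instead.

Let `a` be the `n` points sampled since the last reset, `I` their information gain, `σ(z)` the
posterior standard deviation, and `Q` the quadratic form `vᵀ K (K + λ)⁻¹ v` of the noise `v`
divided by `R`. The estimation error at `z` is at most `(B + R √(Q/λ)) σ(z)` plus a drift term
(`abs_sub_postMean_le`). By the method of mixtures, `M = exp (Q/2 - I)` has expectation at most `1`
in every round (`lintegral_mixture_le_one`): it is updated by Gaussian averages of the exponentials
`exp (g v - g²/2)`, with mean and variance of `g` known before the noise `v` is drawn.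

The width `β` is computed with the maximum information gain `γ_n` in place of `I`. If `σ(z)²` is
much larger than `γ_n/n`, then `I` is smaller than `γ_n` by about `ln (1 + n σ(z)²/(λ γ_n)) / 2`:
replacing a fraction `1/γ_n` of the points by copies of `z` would gain that much, and by Han's
inequality these points can be chosen so that only a bounded amount of information is lost
(`infoGain_add_log_le_maxInfoGain`). Hence failures where `σ(z)` is large are rare, and the two
effects balance to give (`width_defect_le`)
`(B + R √(Q/λ) - β) σ(z) ≤ C R δ M √(γ_n/n)` for all `z`.
The sum of the right-hand sides over all rounds has expectation at most
`C R δ ∑ √(γ_n/n)`, of the order `δ R T √(γ_H/H)`. Markov's inequality at level `δ` costs the factor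
`1/δ`, which cancels the factor `δ` (`IsRun.le_measureReal_mixture`, `sum_regret_le`). The remaining
terms of the regret, `2 β σ(x_t)` and the drift, are summed as usual. When the maximum information
gain is below `1` the kernel is of order `γ_n/n`, and any query has small regret.

For the tuned intervals the two terms of the bound are balanced; where the interval is clamped to
`1` or `T`, the horizon is so short that the trivial bound `2 B T` suffices (`tuning_dichotomy`).
-/

namespace TVBO

/-! ### The regularised kernel matrix and the posterior variance as a minimum -/

section Posterior

variable {X E : Type*} [NormedAddCommGroup E] [InnerProductSpace ℝ E]
  {k : X → X → ℝ} {φ : X → E} {lam : ℝ} {n : ℕ}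

theorem kern_comm (hk : ∀ x y, k x y = inner ℝ (φ x) (φ y)) (x y : X) : k x y = k y x := by
  rw [hk, hk, real_inner_comm]

theorem kernMat_eq_gram (hk : ∀ x y, k x y = inner ℝ (φ x) (φ y)) (a : Fin n → X) :
    kernMat k a = gram ℝ (fun i => φ (a i)) := by
  ext i j
  simp [kernMat, hk]

theorem posSemidef_kernMat (hk : ∀ x y, k x y = inner ℝ (φ x) (φ y)) (a : Fin n → X) :
    (kernMat k a).PosSemidef := by
  rw [kernMat_eq_gram hk]
  exact posSemidef_gram ℝ _

theorem posDef_regularised (hk : ∀ x y, k x y = inner ℝ (φ x) (φ y)) (hlam : 0 < lam)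
    (a : Fin n → X) : (kernMat k a + lam • (1 : Matrix (Fin n) (Fin n) ℝ)).PosDef :=
  PosDef.posSemidef_add (posSemidef_kernMat hk a) (PosDef.one.smul hlam)

theorem dotProduct_kernMat_mulVec (hk : ∀ x y, k x y = inner ℝ (φ x) (φ y)) (a : Fin n → X)
    (v w : Fin n → ℝ) :
    v ⬝ᵥ (kernMat k a *ᵥ w) = inner ℝ (∑ i, v i • φ (a i)) (∑ i, w i • φ (a i)) := by
  simp only [dotProduct, mulVec, kernMat, of_apply, hk, sum_inner, inner_sum, inner_smul_left,
    inner_smul_right, Finset.mul_sum]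
  rw [Finset.sum_comm]
  refine Finset.sum_congr rfl fun i _ => Finset.sum_congr rfl fun j _ => ?_
  simp only [conj_trivial]
  ring

theorem kernVec_dotProduct (hk : ∀ x y, k x y = inner ℝ (φ x) (φ y)) (a : Fin n → X)
    (z : X) (w : Fin n → ℝ) :
    kernVec k a z ⬝ᵥ w = inner ℝ (φ z) (∑ i, w i • φ (a i)) := by
  simp only [dotProduct, kernVec, hk, inner_sum, inner_smul_right]
  refine Finset.sum_congr rfl fun i _ => ?_
  rw [real_inner_comm, mul_comm]

/-- The inverse of the regularised kernel matrix solves the linear system. -/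
theorem regularised_mulVec_inv (hk : ∀ x y, k x y = inner ℝ (φ x) (φ y)) (hlam : 0 < lam)
    (a : Fin n → X) (v : Fin n → ℝ) :
    kernMat k a *ᵥ ((kernMat k a + lam • (1 : Matrix (Fin n) (Fin n) ℝ))⁻¹ *ᵥ v) +
      lam • ((kernMat k a + lam • (1 : Matrix (Fin n) (Fin n) ℝ))⁻¹ *ᵥ v) = v := by
  have hu := (posDef_regularised hk hlam a).isUnit
  rw [Matrix.isUnit_iff_isUnit_det] at hu
  have : (kernMat k a + lam • (1 : Matrix (Fin n) (Fin n) ℝ)) *ᵥ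
      ((kernMat k a + lam • (1 : Matrix (Fin n) (Fin n) ℝ))⁻¹ *ᵥ v) = v := by
    rw [mulVec_mulVec, mul_nonsing_inv _ hu, one_mulVec]
  rwa [add_mulVec, smul_mulVec, one_mulVec] at this

theorem inv_mulVec_eq_of_solves (hk : ∀ x y, k x y = inner ℝ (φ x) (φ y)) (hlam : 0 < lam)
    (a : Fin n → X) {u v : Fin n → ℝ} (h : kernMat k a *ᵥ u + lam • u = v) :
    (kernMat k a + lam • (1 : Matrix (Fin n) (Fin n) ℝ))⁻¹ *ᵥ v = u := by
  have hu := (posDef_regularised hk hlam a).isUnit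
  rw [Matrix.isUnit_iff_isUnit_det] at hu
  have h' : (kernMat k a + lam • (1 : Matrix (Fin n) (Fin n) ℝ)) *ᵥ u = v := by
    simpa [add_mulVec, smul_mulVec] using h
  rw [← h', mulVec_mulVec, nonsing_inv_mul _ hu, one_mulVec]

theorem dotProduct_inv_mulVec_comm (hk : ∀ x y, k x y = inner ℝ (φ x) (φ y)) (hlam : 0 < lam)
    (a : Fin n → X) (v w : Fin n → ℝ) :
    v ⬝ᵥ ((kernMat k a + lam • (1 : Matrix (Fin n) (Fin n) ℝ))⁻¹ *ᵥ w) =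
      w ⬝ᵥ ((kernMat k a + lam • (1 : Matrix (Fin n) (Fin n) ℝ))⁻¹ *ᵥ v) := by
  have h := (posDef_regularised hk hlam a).inv.isHermitian
  have ht : ((kernMat k a + lam • (1 : Matrix (Fin n) (Fin n) ℝ))⁻¹)ᵀ =
      (kernMat k a + lam • (1 : Matrix (Fin n) (Fin n) ℝ))⁻¹ := by
    simpa [IsHermitian, conjTranspose_eq_transpose_of_trivial] using h
  rw [dotProduct_mulVec, ← mulVec_transpose, ht, dotProduct_comm]

/-- The weights of the posterior mean at `z`: it is the combination of the observations with
these coefficients. -/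
noncomputable def postWeight (k : X → X → ℝ) (lam : ℝ) {n : ℕ} (a : Fin n → X) (z : X) :
    Fin n → ℝ :=
  (kernMat k a + lam • (1 : Matrix (Fin n) (Fin n) ℝ))⁻¹ *ᵥ kernVec k a z

theorem postMean_eq_dotProduct (hk : ∀ x y, k x y = inner ℝ (φ x) (φ y)) (hlam : 0 < lam)
    (a : Fin n → X) (v : Fin n → ℝ) (z : X) :
    postMean k lam a v z = v ⬝ᵥ postWeight k lam a z :=
  dotProduct_inv_mulVec_comm hk hlam a _ _

/-- The posterior variance is the minimal cost in the ridge regression of `φ z` on the features of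
the points `a`; `postVar_eq` identifies the minimiser. -/
theorem postVar_le (hk : ∀ x y, k x y = inner ℝ (φ x) (φ y)) (hlam : 0 < lam)
    (a : Fin n → X) (z : X) (v : Fin n → ℝ) :
    postVar k lam a z ≤ ‖φ z - ∑ i, v i • φ (a i)‖ ^ 2 + lam * (v ⬝ᵥ v) := by
  set w := postWeight k lam a z with hw
  have h1 : kernMat k a *ᵥ w + lam • w = kernVec k a z := regularised_mulVec_inv hk hlam a _
  have h2 : postVar k lam a z = k z z - kernVec k a z ⬝ᵥ w := rfl
  have h3 : 0 ≤ (v - w) ⬝ᵥ (kernMat k a *ᵥ (v - w)) := by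
    rw [dotProduct_kernMat_mulVec hk]; exact real_inner_self_nonneg
  have h4 : 0 ≤ (v - w) ⬝ᵥ (v - w) := by
    simpa using dotProduct_star_self_nonneg (v - w)
  have h5 : ‖φ z - ∑ i, v i • φ (a i)‖ ^ 2 =
      k z z - 2 * (kernVec k a z ⬝ᵥ v) + v ⬝ᵥ (kernMat k a *ᵥ v) := by
    rw [norm_sub_sq_real, kernVec_dotProduct hk, dotProduct_kernMat_mulVec hk, hk z z,
      real_inner_self_eq_norm_sq, real_inner_self_eq_norm_sq]
  have h6 : v ⬝ᵥ (kernMat k a *ᵥ w) = w ⬝ᵥ (kernMat k a *ᵥ v) := by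
    rw [dotProduct_kernMat_mulVec hk, dotProduct_kernMat_mulVec hk, real_inner_comm]
  have h7 : v ⬝ᵥ (kernMat k a *ᵥ w) + lam * (v ⬝ᵥ w) = kernVec k a z ⬝ᵥ v := by
    rw [← h1, add_dotProduct, dotProduct_comm _ v, smul_dotProduct, smul_eq_mul,
      dotProduct_comm w v]
  have h8 : w ⬝ᵥ (kernMat k a *ᵥ w) + lam * (w ⬝ᵥ w) = kernVec k a z ⬝ᵥ w := by
    rw [← h1, add_dotProduct, dotProduct_comm (kernMat k a *ᵥ w) w, smul_dotProduct, smul_eq_mul]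
  have h9 : w ⬝ᵥ v = v ⬝ᵥ w := dotProduct_comm _ _
  simp only [mulVec_sub, sub_dotProduct, dotProduct_sub] at h3 h4
  rw [h2, h5]
  nlinarith

theorem postVar_eq (hk : ∀ x y, k x y = inner ℝ (φ x) (φ y)) (hlam : 0 < lam)
    (a : Fin n → X) (z : X) :
    postVar k lam a z = ‖φ z - ∑ i, postWeight k lam a z i • φ (a i)‖ ^ 2 +
      lam * (postWeight k lam a z ⬝ᵥ postWeight k lam a z) := by
  set w := postWeight k lam a z with hw
  have h1 : kernMat k a *ᵥ w + lam • w = kernVec k a z := regularised_mulVec_inv hk hlam a _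
  have h2 : postVar k lam a z = k z z - kernVec k a z ⬝ᵥ w := rfl
  have h5 : ‖φ z - ∑ i, w i • φ (a i)‖ ^ 2 =
      k z z - 2 * (kernVec k a z ⬝ᵥ w) + w ⬝ᵥ (kernMat k a *ᵥ w) := by
    rw [norm_sub_sq_real, kernVec_dotProduct hk, dotProduct_kernMat_mulVec hk, hk z z,
      real_inner_self_eq_norm_sq, real_inner_self_eq_norm_sq]
  have h8 : w ⬝ᵥ (kernMat k a *ᵥ w) + lam * (w ⬝ᵥ w) = kernVec k a z ⬝ᵥ w := by
    rw [← h1, add_dotProduct, dotProduct_comm (kernMat k a *ᵥ w) w, smul_dotProduct, smul_eq_mul]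
  rw [h2, h5]
  linarith

theorem postVar_nonneg (hk : ∀ x y, k x y = inner ℝ (φ x) (φ y)) (hlam : 0 < lam)
    (a : Fin n → X) (z : X) : 0 ≤ postVar k lam a z := by
  have : 0 ≤ postWeight k lam a z ⬝ᵥ postWeight k lam a z := by
    simpa using dotProduct_star_self_nonneg (postWeight k lam a z)
  rw [postVar_eq hk hlam]
  positivity

theorem postVar_le_kern (hk : ∀ x y, k x y = inner ℝ (φ x) (φ y)) (hlam : 0 < lam)
    (a : Fin n → X) (z : X) : postVar k lam a z ≤ k z z := by
  simpa [hk z z, real_inner_self_eq_norm_sq] using postVar_le hk hlam a z 0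

theorem sum_extend_zero {F : Type*} [AddCommMonoid F] {m : ℕ} {e : Fin m → Fin n}
    (he : Function.Injective e) (w : Fin m → ℝ) (g : Fin n → ℝ → F) (hg : ∀ i, g i 0 = 0) :
    ∑ i, g i (Function.extend e w 0 i) = ∑ j, g (e j) (w j) := by
  classical
  rw [← Finset.sum_subset (Finset.subset_univ (Finset.univ.map ⟨e, he⟩))]
  · simp [he.extend_apply]
  · intro i _ hi
    rw [Function.extend_apply' _ _ _ (by simpa using hi)]
    simpa using hg i

/-- More observations decrease the posterior variance. -/
theorem postVar_le_comp (hk : ∀ x y, k x y = inner ℝ (φ x) (φ y)) (hlam : 0 < lam)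
    {m : ℕ} (a : Fin n → X) (e : Fin m → Fin n) (he : Function.Injective e) (z : X) :
    postVar k lam a z ≤ postVar k lam (a ∘ e) z := by
  set w := postWeight k lam (a ∘ e) z with hw
  have h := postVar_le hk hlam a z (Function.extend e w 0)
  rw [postVar_eq hk hlam (a ∘ e) z, ← hw]
  rwa [sum_extend_zero he w (fun i r => r • φ (a i)) (by simp), dotProduct,
    sum_extend_zero he w (fun _ r => r * r) (by simp)] at h

/-- Including the point `z` itself lowers its posterior variance `V` to no less than
`lam * V / (lam + V)`. -/
theorem le_postVar_snoc_self (hk : ∀ x y, k x y = inner ℝ (φ x) (φ y)) (hlam : 0 < lam)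
    (a : Fin n → X) (z : X) :
    lam * postVar k lam a z ≤
      postVar k lam (Fin.snoc a z : Fin (n + 1) → X) z * (lam + postVar k lam a z) := by
  set w := postWeight k lam (Fin.snoc a z : Fin (n + 1) → X) z with hw
  set V := postVar k lam a z with hV
  set c := w (Fin.last n) with hc
  set u : Fin n → ℝ := fun i => w i.castSucc with hu
  have hV0 : 0 ≤ V := postVar_nonneg hk hlam a z
  -- the residual splits off a multiple `1 - c` of `φ z`, to which minimality of `V` applies
  have h1 : (1 - c) ^ 2 * V ≤ ‖(1 - c) • φ z - ∑ i, u i • φ (a i)‖ ^ 2 + lam * (u ⬝ᵥ u) := by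
    by_cases h : 1 - c = 0
    · have : 0 ≤ u ⬝ᵥ u := by simpa using dotProduct_star_self_nonneg u
      calc (1 - c) ^ 2 * V = 0 := by rw [h]; ring
        _ ≤ _ := by positivity
    · have h2 := postVar_le hk hlam a z ((1 - c)⁻¹ • u)
      have h3 : (1 - c) • φ z - ∑ i, u i • φ (a i) =
          (1 - c) • (φ z - ∑ i, ((1 - c)⁻¹ • u) i • φ (a i)) := by
        rw [smul_sub, Finset.smul_sum]
        congr 1
        refine Finset.sum_congr rfl fun i _ => ?_
        rw [smul_smul, Pi.smul_apply, smul_eq_mul, mul_inv_cancel_left₀ h]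
      have h4 : u ⬝ᵥ u = (1 - c) ^ 2 * (((1 - c)⁻¹ • u) ⬝ᵥ ((1 - c)⁻¹ • u)) := by
        rw [smul_dotProduct, dotProduct_smul, smul_eq_mul, smul_eq_mul]
        field_simp
      rw [h3, norm_smul, mul_pow, h4, Real.norm_eq_abs, sq_abs]
      nlinarith [sq_nonneg (1 - c)]
  have h5 := postVar_eq hk hlam (Fin.snoc a z : Fin (n + 1) → X) z
  rw [← hw, Fin.sum_univ_castSucc, dotProduct, Fin.sum_univ_castSucc] at h5
  simp only [Fin.snoc_castSucc, Fin.snoc_last, ← hc] at h5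
  have h6 : φ z - (∑ i : Fin n, w i.castSucc • φ (a i) + c • φ z) =
      (1 - c) • φ z - ∑ i, u i • φ (a i) := by
    rw [sub_smul, one_smul]; abel
  rw [h6] at h5
  have h7 : (1 - c) ^ 2 * V + lam * c ^ 2 ≤ postVar k lam (Fin.snoc a z : Fin (n + 1) → X) z := by
    rw [h5]
    simp only [dotProduct, hu] at h1
    nlinarith
  have h8 : lam * V ≤ ((1 - c) ^ 2 * V + lam * c ^ 2) * (lam + V) := by
    nlinarith [sq_nonneg ((1 - c) * V - lam * c)]
  exact h8.trans (mul_le_mul_of_nonneg_right h7 (by positivity))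

end Posterior

/-! ### Information gain: chain rule, removal of points, repeated points -/

section Information

variable {X E : Type*} [NormedAddCommGroup E] [InnerProductSpace ℝ E]
  {k : X → X → ℝ} {φ : X → E} {lam : ℝ} {n : ℕ}

/-- The information gain `(1/2) ln det (I + λ⁻¹ K_a)` of the points `a`. -/
noncomputable def infoGain (k : X → X → ℝ) (lam : ℝ) {n : ℕ} (a : Fin n → X) : ℝ :=
  (1 / 2 : ℝ) * Real.log (1 + lam⁻¹ • kernMat k a).det

theorem det_regularised (hlam : 0 < lam) (a : Fin n → X) :
    (kernMat k a + lam • (1 : Matrix (Fin n) (Fin n) ℝ)).det =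
      lam ^ n * (1 + lam⁻¹ • kernMat k a).det := by
  have : kernMat k a + lam • (1 : Matrix (Fin n) (Fin n) ℝ) =
      lam • (1 + lam⁻¹ • kernMat k a) := by
    rw [smul_add, smul_smul, mul_inv_cancel₀ hlam.ne', one_smul, add_comm]
  rw [this, det_smul, Fintype.card_fin]

theorem det_one_add_pos (hk : ∀ x y, k x y = inner ℝ (φ x) (φ y)) (hlam : 0 < lam)
    (a : Fin n → X) : 0 < (1 + lam⁻¹ • kernMat k a).det :=
  (PosDef.one.add_posSemidef ((posSemidef_kernMat hk a).smul (inv_nonneg.2 hlam.le))).det_pos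

/-- Chain rule for the determinant, by the Schur complement; the point `a i` that comes last
may stand at any place of the list. -/
theorem det_succAbove (hk : ∀ x y, k x y = inner ℝ (φ x) (φ y)) (hlam : 0 < lam)
    (a : Fin (n + 1) → X) (i : Fin (n + 1)) :
    (1 + lam⁻¹ • kernMat k a).det =
      (1 + lam⁻¹ • kernMat k (a ∘ i.succAbove)).det *
        (1 + postVar k lam (a ∘ i.succAbove) (a i) / lam) := by
  set b := a ∘ i.succAbove with hb
  set A := kernMat k b + lam • (1 : Matrix (Fin n) (Fin n) ℝ) with hA
  have hpd : A.PosDef := posDef_regularised hk hlam b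
  have hu := hpd.isUnit
  rw [Matrix.isUnit_iff_isUnit_det] at hu
  have : Invertible A := A.invertibleOfIsUnitDet hu
  let e : Fin (n + 1) ≃ Fin n ⊕ PUnit.{1} :=
    (finSuccEquiv' i).trans (Equiv.optionEquivSumPUnit (Fin n))
  have hl : ∀ j, e.symm (Sum.inl j) = i.succAbove j := by intro j; simp [e]
  have hr : e.symm (Sum.inr ()) = i := by simp [e]
  have hblock : (kernMat k a + lam • (1 : Matrix (Fin (n + 1)) (Fin (n + 1)) ℝ)).submatrix
      e.symm e.symm = fromBlocks A (of fun j _ => kernVec k b (a i) j)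
        (of fun _ j => kernVec k b (a i) j) (of fun _ _ => k (a i) (a i) + lam) := by
    ext p q
    rcases p with p | ⟨⟩ <;> rcases q with q | ⟨⟩
    · simp [hl, hA, hb, kernMat, Matrix.one_apply]
    · simp [hl, hr, kernMat, kernVec, hb]
    · simp [hl, hr, kernMat, kernVec, hb, kern_comm hk (a i)]
    · simp [hr, kernMat]
  have hdet : (kernMat k a + lam • (1 : Matrix (Fin (n + 1)) (Fin (n + 1)) ℝ)).det =
      A.det * (lam + postVar k lam b (a i)) := by
    rw [← det_submatrix_equiv_self e.symm, hblock, det_fromBlocks₁₁, det_unique (n := PUnit.{1})]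
    congr 1
    rw [Matrix.mul_assoc, invOf_eq_nonsing_inv, Matrix.sub_apply, Matrix.mul_apply, postVar, ← hA]
    have : ∀ j, (A⁻¹ * (of fun j _ => kernVec k b (a i) j : Matrix (Fin n) PUnit.{1} ℝ)) j default
        = (A⁻¹ *ᵥ kernVec k b (a i)) j := by
      intro j; simp [Matrix.mul_apply, mulVec, dotProduct]
    simp only [this, of_apply, dotProduct]
    ring_nf
  rw [det_regularised hlam, hA, det_regularised hlam] at hdet
  have hl0 := hlam.ne'
  have hp : lam ^ (n + 1) ≠ 0 := by positivity
  apply mul_left_cancel₀ hp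
  rw [hdet]
  generalize (1 + lam⁻¹ • kernMat k b).det = D
  generalize postVar k lam b (a i) = V
  field_simp
  ring

theorem infoGain_succAbove (hk : ∀ x y, k x y = inner ℝ (φ x) (φ y)) (hlam : 0 < lam)
    (a : Fin (n + 1) → X) (i : Fin (n + 1)) :
    infoGain k lam a = infoGain k lam (a ∘ i.succAbove) +
      (1 / 2 : ℝ) * Real.log (1 + postVar k lam (a ∘ i.succAbove) (a i) / lam) := by
  have hv : 0 ≤ postVar k lam (a ∘ i.succAbove) (a i) / lam :=
    div_nonneg (postVar_nonneg hk hlam _ _) hlam.le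
  rw [infoGain, det_succAbove hk hlam a i,
    Real.log_mul (det_one_add_pos hk hlam _).ne' (by positivity), infoGain]
  ring

theorem infoGain_fin_zero (a : Fin 0 → X) : infoGain k lam a = 0 := by
  simp [infoGain]

/-- Chain rule: the information gain of the first `n` points of a sequence, as a sum over the
successive posterior variances. -/
theorem infoGain_eq_sum (hk : ∀ x y, k x y = inner ℝ (φ x) (φ y)) (hlam : 0 < lam)
    (x : ℕ → X) (n : ℕ) :
    infoGain k lam (fun i : Fin n => x i) = ∑ i ∈ Finset.range n,
      (1 / 2 : ℝ) * Real.log (1 + postVar k lam (fun j : Fin i => x j) (x i) / lam) := by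
  induction n with
  | zero => simp [infoGain_fin_zero]
  | succ n ih =>
    rw [Finset.sum_range_succ, ← ih, infoGain_succAbove hk hlam _ (Fin.last n)]
    have : (fun i : Fin (n + 1) => x i) ∘ (Fin.last n).succAbove = fun i : Fin n => x i := by
      ext i; simp
    rw [this]
    simp

theorem exists_seq_extension (a : Fin (n + 1) → X) :
    ∃ x : ℕ → X, a = fun i : Fin (n + 1) => x i :=
  ⟨fun j => a (Fin.ofNat (n + 1) j), by ext i; simp⟩

theorem log_one_add_postVar_nonneg (hk : ∀ x y, k x y = inner ℝ (φ x) (φ y)) (hlam : 0 < lam)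
    (a : Fin n → X) (z : X) : 0 ≤ Real.log (1 + postVar k lam a z / lam) := by
  have : 0 ≤ postVar k lam a z / lam := div_nonneg (postVar_nonneg hk hlam _ _) hlam.le
  exact Real.log_nonneg (by linarith)

theorem infoGain_nonneg (hk : ∀ x y, k x y = inner ℝ (φ x) (φ y)) (hlam : 0 < lam)
    (a : Fin n → X) : 0 ≤ infoGain k lam a := by
  cases n with
  | zero => rw [infoGain_fin_zero]
  | succ n =>
    obtain ⟨x, rfl⟩ := exists_seq_extension a
    rw [infoGain_eq_sum hk hlam x (n + 1)]
    exact Finset.sum_nonneg fun i _ =>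
      mul_nonneg (by norm_num) (log_one_add_postVar_nonneg hk hlam _ _)

theorem infoGain_le (hk : ∀ x y, k x y = inner ℝ (φ x) (φ y)) (hlam : 0 < lam)
    (hk1 : ∀ z, k z z ≤ 1) (a : Fin n → X) : infoGain k lam a ≤ n * (1 / (2 * lam)) := by
  cases n with
  | zero => simp [infoGain_fin_zero]
  | succ n =>
    obtain ⟨x, rfl⟩ := exists_seq_extension a
    rw [infoGain_eq_sum hk hlam x (n + 1), ← nsmul_eq_mul]
    conv_rhs => rw [← Finset.card_range (n + 1)]
    refine Finset.sum_le_card_nsmul _ _ _ fun i _ => ?_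
    have h0 : 0 ≤ postVar k lam (fun j : Fin i => x j) (x i) / lam :=
      div_nonneg (postVar_nonneg hk hlam _ _) hlam.le
    have h1 : postVar k lam (fun j : Fin i => x j) (x i) / lam ≤ 1 / lam :=
      div_le_div_of_nonneg_right ((postVar_le_kern hk hlam _ _).trans (hk1 _)) hlam.le
    have h2 := Real.log_le_sub_one_of_pos
      (show 0 < 1 + postVar k lam (fun j : Fin i => x j) (x i) / lam by linarith)
    rw [one_div_mul_eq_div, div_le_iff₀ (by norm_num)]
    have h3 : 1 / (2 * lam) * 2 = 1 / lam := by field_simp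
    linarith

/-- Han's inequality for the information gain: some point can be removed at the cost of at most
the fraction `1 / (n + 1)` of the information, because conditioning on more points lowers the
increments in the chain rule. -/
theorem exists_infoGain_succAbove_ge (hk : ∀ x y, k x y = inner ℝ (φ x) (φ y)) (hlam : 0 < lam)
    (a : Fin (n + 1) → X) :
    ∃ i : Fin (n + 1), n * infoGain k lam a ≤ (n + 1) * infoGain k lam (a ∘ i.succAbove) := by
  have hsum : ∑ i, (infoGain k lam a - infoGain k lam (a ∘ Fin.succAbove i)) ≤
      ∑ _i : Fin (n + 1), infoGain k lam a / (n + 1) := by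
    have h1 : ∑ _i : Fin (n + 1), infoGain k lam a / (n + 1) = infoGain k lam a := by
      rw [Finset.sum_const, Finset.card_univ, Fintype.card_fin, nsmul_eq_mul]
      push_cast
      field_simp
    rw [h1]
    obtain ⟨x, hx⟩ := exists_seq_extension a
    have h2 : infoGain k lam a = ∑ i : Fin (n + 1),
        (1 / 2 : ℝ) * Real.log (1 + postVar k lam (fun j : Fin i => x j) (x i) / lam) := by
      rw [hx, infoGain_eq_sum hk hlam x (n + 1), Finset.sum_range]
    conv_rhs => rw [h2]
    refine Finset.sum_le_sum fun i _ => ?_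
    rw [infoGain_succAbove hk hlam a i, add_sub_cancel_left]
    have hai : a i = x i := by rw [hx]
    have hpre : (fun j : Fin i => x j) = (a ∘ i.succAbove) ∘
        (fun j : Fin (i : ℕ) => (⟨j, by omega⟩ : Fin n)) := by
      ext j
      have : i.succAbove ⟨j, by omega⟩ = ⟨j, by omega⟩ := by
        rw [Fin.succAbove_of_castSucc_lt _ _ (by simp [Fin.lt_def])]
        rfl
      simp [this, hx]
    have hmono : postVar k lam (a ∘ i.succAbove) (a i) ≤
        postVar k lam (fun j : Fin i => x j) (x i) := by
      rw [hpre, hai]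
      refine postVar_le_comp hk hlam _ _ ?_ _
      intro p q hpq
      simpa [Fin.ext_iff] using hpq
    have h0 : 0 ≤ postVar k lam (a ∘ i.succAbove) (a i) / lam :=
      div_nonneg (postVar_nonneg hk hlam _ _) hlam.le
    gcongr
  obtain ⟨i, _, hi⟩ := Finset.exists_le_of_sum_le Finset.univ_nonempty hsum
  refine ⟨i, ?_⟩
  have hn : (0 : ℝ) < n + 1 := by positivity
  rw [le_div_iff₀ hn] at hi
  linarith

/-- Any number `m` of the `n` points can be kept so that the fraction `m / n` of the information
remains. -/
theorem exists_injective_infoGain_ge (hk : ∀ x y, k x y = inner ℝ (φ x) (φ y)) (hlam : 0 < lam)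
    {n m : ℕ} (hm : m ≤ n) (a : Fin n → X) :
    ∃ e : Fin m → Fin n, Function.Injective e ∧
      m * infoGain k lam a ≤ n * infoGain k lam (a ∘ e) := by
  induction n with
  | zero =>
    obtain rfl : m = 0 := by omega
    exact ⟨id, Function.injective_id, le_refl _⟩
  | succ n ih =>
    rcases Nat.lt_or_ge n m with h | h
    · obtain rfl : m = n + 1 := by omega
      exact ⟨id, Function.injective_id, le_refl _⟩
    obtain ⟨i, hi⟩ := exists_infoGain_succAbove_ge hk hlam a
    obtain ⟨e, he, hle⟩ := ih h (a ∘ i.succAbove)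
    refine ⟨i.succAbove ∘ e, Fin.succAbove_right_injective.comp he, ?_⟩
    rcases Nat.eq_zero_or_pos m with rfl | hm0
    · simpa using mul_nonneg (by positivity : (0 : ℝ) ≤ (n : ℝ) + 1) (infoGain_nonneg hk hlam _)
    have hn : (0 : ℝ) < n := by exact_mod_cast hm0.trans_le h
    rw [← Function.comp_assoc]
    set G := infoGain k lam ((a ∘ i.succAbove) ∘ e)
    have h1 : n * (m * infoGain k lam a) ≤ n * (((n + 1 : ℕ) : ℝ) * G) := by
      calc n * (m * infoGain k lam a) = m * (n * infoGain k lam a) := by ring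
        _ ≤ m * ((n + 1) * infoGain k lam (a ∘ i.succAbove)) := by gcongr
        _ = (n + 1) * (m * infoGain k lam (a ∘ i.succAbove)) := by ring
        _ ≤ (n + 1) * (n * G) := by gcongr
        _ = n * (((n + 1 : ℕ) : ℝ) * G) := by push_cast; ring
    exact le_of_mul_le_mul_left h1 hn

/-- Appending `j` copies of `z` multiplies the determinant by at least `1 + j V / λ`, where `V` is
the posterior variance of `z`. -/
theorem exists_repeat (hk : ∀ x y, k x y = inner ℝ (φ x) (φ y)) (hlam : 0 < lam)
    {m : ℕ} (a : Fin m → X) (z : X) (j : ℕ) :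
    ∃ b : Fin (m + j) → X, infoGain k lam a +
        (1 / 2 : ℝ) * Real.log (1 + j * (postVar k lam a z / lam)) ≤ infoGain k lam b ∧
      lam * postVar k lam a z ≤ postVar k lam b z * (lam + j * postVar k lam a z) := by
  set V := postVar k lam a z with hV
  have hV0 : 0 ≤ V := postVar_nonneg hk hlam a z
  induction j with
  | zero => exact ⟨a, by simp, by rw [← hV]; simp [mul_comm]⟩
  | succ j ih =>
    obtain ⟨b, hb1, hb2⟩ := ih
    set W := postVar k lam b z with hW
    have hW0 : 0 ≤ W := postVar_nonneg hk hlam b z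
    have hsnoc := le_postVar_snoc_self hk hlam b z
    refine ⟨(Fin.snoc b z : Fin (m + j + 1) → X), ?_, ?_⟩
    · rw [infoGain_succAbove hk hlam (Fin.snoc b z : Fin (m + j + 1) → X) (Fin.last _)]
      have hcomp : (Fin.snoc b z : Fin (m + j + 1) → X) ∘ (Fin.last (m + j)).succAbove = b := by
        ext i; simp
      rw [hcomp, Fin.snoc_last, ← hW]
      refine le_trans ?_ (add_le_add_left hb1 _)
      rw [add_assoc, ← mul_add, ← Real.log_mul (by positivity) (by positivity)]
      have hle : 1 + ((j + 1 : ℕ) : ℝ) * (V / lam) ≤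
          (1 + j * (V / lam)) * (1 + W / lam) := by
        have : V / lam ≤ (1 + j * (V / lam)) * (W / lam) := by
          rw [show (1 + j * (V / lam)) * (W / lam) = W * (lam + j * V) / lam / lam by
            field_simp, div_le_div_iff_of_pos_right hlam, le_div_iff₀ hlam]
          linarith
        push_cast
        nlinarith
      gcongr
    · rw [← hW] at hsnoc
      set W' := postVar k lam (Fin.snoc b z : Fin (m + j + 1) → X) z with hW'
      have hW'0 : 0 ≤ W' := postVar_nonneg hk hlam _ z
      push_cast
      rcases hV0.eq_or_lt with h0 | hVpos
      · rw [← h0]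
        simpa using mul_nonneg hW'0 hlam.le
      have hWpos : 0 < W := by
        by_contra hcon
        have : W = 0 := le_antisymm (not_lt.1 hcon) hW0
        rw [this, zero_mul] at hb2
        exact absurd hb2 (not_le.2 (by positivity))
      -- with `1 / W ≤ 1 / V + j / λ`, one more copy adds at most `1 / λ` to the inverse variance
      have h1 : lam * V * (lam + W) ≤ W * (lam * (lam + (j + 1) * V)) := by nlinarith
      have h2 : W * (lam * V) ≤ W * (W' * (lam + (j + 1) * V)) := by
        have h3 : lam * W * (lam * (lam + (j + 1) * V)) ≤
            W' * (lam + W) * (lam * (lam + (j + 1) * V)) :=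
          mul_le_mul_of_nonneg_right hsnoc (by positivity)
        have h4 : (lam + W) * (lam * (W * (lam * V))) ≤
            (lam + W) * (lam * (W * (W' * (lam + (j + 1) * V)))) := by
          calc (lam + W) * (lam * (W * (lam * V)))
              = (lam * V * (lam + W)) * (lam * W) := by ring
            _ ≤ (W * (lam * (lam + (j + 1) * V))) * (lam * W) := by gcongr
            _ = W * (lam * W * (lam * (lam + (j + 1) * V))) := by ring
            _ ≤ W * (W' * (lam + W) * (lam * (lam + (j + 1) * V))) := by gcongr
            _ = _ := by ring
        exact le_of_mul_le_mul_left (le_of_mul_le_mul_left h4 (by positivity)) hlam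
      exact le_of_mul_le_mul_left h2 hWpos

/-! ### The maximum information gain -/

theorem infoGain_le_maxInfoGain (hk : ∀ x y, k x y = inner ℝ (φ x) (φ y)) (hlam : 0 < lam)
    (hk1 : ∀ z, k z z ≤ 1) (a : Fin n → X) : infoGain k lam a ≤ maxInfoGain k lam n :=
  le_ciSup (f := fun a : Fin n → X => infoGain k lam a)
    ⟨n * (1 / (2 * lam)), by rintro _ ⟨b, rfl⟩; exact infoGain_le hk hlam hk1 b⟩ a

theorem maxInfoGain_le (hk : ∀ x y, k x y = inner ℝ (φ x) (φ y)) (hlam : 0 < lam)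
    (hk1 : ∀ z, k z z ≤ 1) (n : ℕ) : maxInfoGain k lam n ≤ n * (1 / (2 * lam)) :=
  Real.iSup_le (fun a => infoGain_le hk hlam hk1 a) (by positivity)

theorem maxInfoGain_nonneg (hk : ∀ x y, k x y = inner ℝ (φ x) (φ y)) (hlam : 0 < lam) (n : ℕ) :
    0 ≤ maxInfoGain k lam n :=
  Real.iSup_nonneg fun a => infoGain_nonneg hk hlam a

theorem maxInfoGain_mono [Nonempty X] (hk : ∀ x y, k x y = inner ℝ (φ x) (φ y)) (hlam : 0 < lam)
    (hk1 : ∀ z, k z z ≤ 1) : Monotone (maxInfoGain k lam) := by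
  refine monotone_nat_of_le_succ fun n => ciSup_le fun a => ?_
  obtain ⟨z⟩ := ‹Nonempty X›
  obtain ⟨b, hb, _⟩ := exists_repeat hk hlam a z 1
  refine le_trans ?_ (infoGain_le_maxInfoGain hk hlam hk1 b)
  refine le_trans ?_ hb
  have : 0 ≤ postVar k lam a z / lam := div_nonneg (postVar_nonneg hk hlam _ _) hlam.le
  have : 0 ≤ Real.log (1 + (1 : ℕ) * (postVar k lam a z / lam)) :=
    Real.log_nonneg (by simpa using this)
  change infoGain k lam a ≤ _
  linarith

theorem log_one_add_mul_kern_le_maxInfoGain (hk : ∀ x y, k x y = inner ℝ (φ x) (φ y))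
    (hlam : 0 < lam) (hk1 : ∀ z, k z z ≤ 1) (n : ℕ) (z : X) :
    (1 / 2 : ℝ) * Real.log (1 + n * (k z z / lam)) ≤ maxInfoGain k lam n := by
  obtain ⟨b, hb, _⟩ := exists_repeat hk hlam (Fin.elim0 : Fin 0 → X) z n
  have h0 : postVar k lam (Fin.elim0 : Fin 0 → X) z = k z z := by simp [postVar]
  rw [infoGain_fin_zero, h0, zero_add] at hb
  refine hb.trans ?_
  exact (infoGain_le_maxInfoGain hk hlam hk1 b).trans_eq (by rw [Nat.zero_add])

/-- If the maximum information gain of `n` points is at most `1`, the kernel is of order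
`γ_n / n`. -/
theorem mul_kern_le_of_maxInfoGain_le_one (hk : ∀ x y, k x y = inner ℝ (φ x) (φ y))
    (hlam : 0 < lam) (hk1 : ∀ z, k z z ≤ 1) {n : ℕ} (hg : maxInfoGain k lam n ≤ 1) (z : X) :
    n * k z z ≤ 2 * Real.exp 2 * lam * maxInfoGain k lam n := by
  set g := maxInfoGain k lam n
  have hg0 : 0 ≤ g := maxInfoGain_nonneg hk hlam n
  have hkz : 0 ≤ k z z := by rw [hk]; exact real_inner_self_nonneg
  have h1 := log_one_add_mul_kern_le_maxInfoGain hk hlam hk1 n z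
  have h2 : 1 + n * (k z z / lam) ≤ Real.exp (2 * g) := by
    rw [← Real.log_le_iff_le_exp (by positivity)]
    linarith
  have h3 : Real.exp (2 * g) * (1 - 2 * g) ≤ 1 := by
    have h4 := Real.add_one_le_exp (-(2 * g))
    have h5 : Real.exp (2 * g) * Real.exp (-(2 * g)) = 1 := by rw [← Real.exp_add]; simp
    nlinarith [Real.exp_pos (2 * g)]
  have h6 : Real.exp (2 * g) ≤ Real.exp 2 := Real.exp_le_exp.2 (by linarith)
  have h7 : n * (k z z / lam) ≤ 2 * Real.exp 2 * g := by nlinarith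
  calc n * k z z = n * (k z z / lam) * lam := by field_simp
    _ ≤ 2 * Real.exp 2 * g * lam := by gcongr
    _ = _ := by ring

/-- The information gain of `n` points falls short of its maximum by about `ln (1 + n V / γ_n) / 2`
if some point `z` still has posterior variance `V`: replacing `n / γ_n` of the points, chosen by
Han's inequality at the cost of a bounded amount of information, by copies of `z` gains that
much. -/
theorem infoGain_add_log_le_maxInfoGain (hk : ∀ x y, k x y = inner ℝ (φ x) (φ y))
    (hlam : 0 < lam) (hk1 : ∀ z, k z z ≤ 1) (hn : 1 ≤ n) (hg : 1 ≤ maxInfoGain k lam n)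
    (a : Fin n → X) (z : X) :
    infoGain k lam a + (1 / 2 : ℝ) *
        Real.log (1 + n / maxInfoGain k lam n * (postVar k lam a z / lam)) ≤
      maxInfoGain k lam n + (1 + 1 / (2 * lam)) := by
  set g := maxInfoGain k lam n with hgdef
  have hn0 : (0 : ℝ) < n := by exact_mod_cast hn
  have hg0 : 0 < g := by linarith
  set j := ⌈(n : ℝ) / g⌉₊ with hj
  have hjn : j ≤ n := by
    rw [hj, Nat.ceil_le, div_le_iff₀ hg0]
    nlinarith
  have hj1 : (n : ℝ) / g ≤ j := Nat.le_ceil _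
  have hj2 : (j : ℝ) < n / g + 1 := Nat.ceil_lt_add_one (by positivity)
  obtain ⟨e, he, hle⟩ := exists_injective_infoGain_ge hk hlam (Nat.sub_le n j) a
  obtain ⟨b, hb, _⟩ := exists_repeat hk hlam (a ∘ e) z j
  have hbg : infoGain k lam b ≤ g :=
    (infoGain_le_maxInfoGain hk hlam hk1 b).trans_eq (by rw [Nat.sub_add_cancel hjn])
  have hmono := postVar_le_comp hk hlam a e he z
  have hV0 : 0 ≤ postVar k lam a z := postVar_nonneg hk hlam a z
  have hlog : Real.log (1 + n / g * (postVar k lam a z / lam)) ≤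
      Real.log (1 + j * (postVar k lam (a ∘ e) z / lam)) := by
    gcongr
  have hag : infoGain k lam a ≤ g := infoGain_le_maxInfoGain hk hlam hk1 a
  have ha0 : 0 ≤ infoGain k lam a := infoGain_nonneg hk hlam a
  rw [Nat.cast_sub hjn] at hle
  have hloss : infoGain k lam a - infoGain k lam (a ∘ e) ≤ 1 + 1 / (2 * lam) := by
    have h1 : n * (infoGain k lam a - infoGain k lam (a ∘ e)) ≤ j * g := by nlinarith
    have h2 : (j : ℝ) * g ≤ n + g := by
      calc (j : ℝ) * g ≤ (n / g + 1) * g := by gcongr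
        _ = n + g := by field_simp
    have h3 : g ≤ n * (1 / (2 * lam)) := maxInfoGain_le hk hlam hk1 n
    nlinarith
  linarith

end Information

/-! ### Estimation error of the posterior mean -/

section Noise

variable {X E : Type*} [NormedAddCommGroup E] [InnerProductSpace ℝ E]
  {k : X → X → ℝ} {φ : X → E} {lam : ℝ} {n : ℕ}

/-- The quadratic form `vᵀ K (K + λ)⁻¹ v` of a noise vector `v`, written as
`vᵀ v - λ vᵀ (K + λ)⁻¹ v`. It is `λ` times the square of the self-normalised norm of
`∑ v_i φ(a_i)`. -/
noncomputable def noiseQuad (k : X → X → ℝ) (lam : ℝ) {n : ℕ} (a : Fin n → X) (v : Fin n → ℝ) :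
    ℝ :=
  v ⬝ᵥ v - lam * (v ⬝ᵥ ((kernMat k a + lam • (1 : Matrix (Fin n) (Fin n) ℝ))⁻¹ *ᵥ v))

theorem noiseQuad_smul (r : ℝ) (a : Fin n → X) (v : Fin n → ℝ) :
    noiseQuad k lam a (r • v) = r ^ 2 * noiseQuad k lam a v := by
  simp only [noiseQuad, mulVec_smul, smul_dotProduct, dotProduct_smul, smul_eq_mul]
  ring

/-- Self-normalised Cauchy-Schwarz bound for the contribution of the noise to the posterior
mean. -/
theorem abs_dotProduct_postWeight_le (hk : ∀ x y, k x y = inner ℝ (φ x) (φ y)) (hlam : 0 < lam)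
    (a : Fin n → X) (v : Fin n → ℝ) (z : X) :
    |v ⬝ᵥ postWeight k lam a z| ≤ √(noiseQuad k lam a v / lam) * postStd k lam a z := by
  set u := (kernMat k a + lam • (1 : Matrix (Fin n) (Fin n) ℝ))⁻¹ *ᵥ v with hu
  set w := postWeight k lam a z with hw
  set S : E := ∑ i, u i • φ (a i)
  set y : Fin n → ℝ := kernMat k a *ᵥ u with hy
  set r : E := φ z - ∑ i, w i • φ (a i)
  have hv : y + lam • u = v := regularised_mulVec_inv hk hlam a v
  have hS : u ⬝ᵥ y = ‖S‖ ^ 2 := by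
    rw [hy, dotProduct_kernMat_mulVec hk, real_inner_self_eq_norm_sq]
  have hQ : noiseQuad k lam a v / lam = ‖S‖ ^ 2 + lam⁻¹ * (y ⬝ᵥ y) := by
    have h2 : noiseQuad k lam a v = v ⬝ᵥ v - lam * (v ⬝ᵥ u) := rfl
    rw [h2, ← hv, ← hS]
    simp only [add_dotProduct, dotProduct_add, smul_dotProduct, dotProduct_smul, smul_eq_mul,
      dotProduct_comm u y]
    field_simp
    ring
  -- pairing with the noise splits into a residual part and a part in the span of the data
  have hpair : v ⬝ᵥ w = inner ℝ r S + w ⬝ᵥ y := by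
    have h1 : v ⬝ᵥ w = kernVec k a z ⬝ᵥ u := dotProduct_inv_mulVec_comm hk hlam a v _
    rw [h1, kernVec_dotProduct hk, inner_sub_left, hy, dotProduct_kernMat_mulVec hk]
    ring
  have hV : postVar k lam a z = ‖r‖ ^ 2 + lam * (w ⬝ᵥ w) := postVar_eq hk hlam a z
  have hyy : 0 ≤ y ⬝ᵥ y := by simpa using dotProduct_star_self_nonneg y
  have hww : 0 ≤ w ⬝ᵥ w := by simpa using dotProduct_star_self_nonneg w
  rw [postStd, ← Real.sqrt_mul (by rw [hQ]; positivity)]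
  apply Real.abs_le_sqrt
  rw [hQ, hV, hpair]
  have h1 : |inner ℝ r S| ≤ ‖r‖ * ‖S‖ := abs_real_inner_le_norm r S
  have h2 : (w ⬝ᵥ y) ^ 2 ≤ (w ⬝ᵥ w) * (y ⬝ᵥ y) := by
    have := Finset.sum_mul_sq_le_sq_mul_sq Finset.univ w y
    simpa [dotProduct, sq] using this
  set A := inner ℝ r S
  set D := w ⬝ᵥ y
  set W := √(w ⬝ᵥ w) with hW
  set Y := √(y ⬝ᵥ y) with hY
  have hW2 : W ^ 2 = w ⬝ᵥ w := Real.sq_sqrt hww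
  have hY2 : Y ^ 2 = y ⬝ᵥ y := Real.sq_sqrt hyy
  have h3 : |D| ≤ W * Y := by
    rw [hW, hY, ← Real.sqrt_mul hww]
    exact Real.abs_le_sqrt h2
  have h4 : (A + D) ^ 2 ≤ (‖r‖ * ‖S‖ + W * Y) ^ 2 := by
    apply sq_le_sq'
    · linarith [neg_abs_le A, neg_abs_le D]
    · linarith [le_abs_self A, le_abs_self D]
  refine h4.trans ?_
  rw [← hW2, ← hY2]
  have h5 : (‖S‖ ^ 2 + lam⁻¹ * Y ^ 2) * (‖r‖ ^ 2 + lam * W ^ 2) =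
      (‖r‖ * ‖S‖ + W * Y) ^ 2 + lam⁻¹ * (lam * W * ‖S‖ - ‖r‖ * Y) ^ 2 := by
    field_simp
    ring
  rw [h5]
  have : 0 ≤ lam⁻¹ * (lam * W * ‖S‖ - ‖r‖ * Y) ^ 2 := by positivity
  linarith

theorem norm_feature_le_one (hk : ∀ x y, k x y = inner ℝ (φ x) (φ y)) (hk1 : ∀ z, k z z ≤ 1) (z : X) :
    ‖φ z‖ ≤ 1 := by
  have h := hk1 z
  rw [hk, real_inner_self_eq_norm_sq] at h
  nlinarith [norm_nonneg (φ z)]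

/-- Error of the posterior mean as an estimate of the current function `g`, when the observation
at `a i` is the value there of an older function `f i`, at distance at most `D` from `g`, plus
the noise `v i`. -/
theorem abs_sub_postMean_le (hk : ∀ x y, k x y = inner ℝ (φ x) (φ y)) (hlam : 0 < lam)
    (hk1 : ∀ z, k z z ≤ 1) (a : Fin n → X) (f : Fin n → E) (g : E) {B D : ℝ} (hg : ‖g‖ ≤ B)
    (hD : ∀ i, ‖f i - g‖ ≤ D) (hD0 : 0 ≤ D) (v : Fin n → ℝ) (z : X) :
    |inner ℝ (φ z) g - postMean k lam a (fun i => inner ℝ (φ (a i)) (f i) + v i) z| ≤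
      (B + √(noiseQuad k lam a v / lam)) * postStd k lam a z + √(n / lam) * D := by
  have hpm := postMean_eq_dotProduct hk hlam a (fun i => inner ℝ (φ (a i)) (f i) + v i) z
  have hV := postVar_eq hk hlam a z
  set w := postWeight k lam a z with hw
  have hww : 0 ≤ w ⬝ᵥ w := by simpa using dotProduct_star_self_nonneg w
  have hdec : inner ℝ (φ z) g - postMean k lam a (fun i => inner ℝ (φ (a i)) (f i) + v i) z =
      inner ℝ (φ z - ∑ i, w i • φ (a i)) g - (∑ i, w i * inner ℝ (φ (a i)) (f i - g))
        - v ⬝ᵥ w := by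
    rw [hpm]
    simp only [dotProduct, inner_sub_left, inner_sub_right, sum_inner, inner_smul_left,
      conj_trivial, mul_sub, add_mul, Finset.sum_add_distrib, Finset.sum_sub_distrib]
    simp only [mul_comm]
    ring
  have hnoise := abs_dotProduct_postWeight_le hk hlam a v z
  rw [← hw] at hnoise
  have hbias : |inner ℝ (φ z - ∑ i, w i • φ (a i)) g| ≤ B * postStd k lam a z := by
    refine (abs_real_inner_le_norm _ _).trans ?_
    rw [mul_comm]
    refine mul_le_mul hg ?_ (norm_nonneg _) ((norm_nonneg _).trans hg)
    apply Real.le_sqrt_of_sq_le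
    rw [hV]
    have : 0 ≤ lam * (w ⬝ᵥ w) := by positivity
    linarith
  have hVone : postVar k lam a z ≤ 1 := (postVar_le_kern hk hlam a z).trans (hk1 z)
  have hdrift : |∑ i, w i * inner ℝ (φ (a i)) (f i - g)| ≤ √(n / lam) * D := by
    have hterm : ∀ i, |inner ℝ (φ (a i)) (f i - g)| ≤ D := fun i =>
      calc |inner ℝ (φ (a i)) (f i - g)| ≤ ‖φ (a i)‖ * ‖f i - g‖ := abs_real_inner_le_norm _ _
        _ ≤ 1 * D := mul_le_mul (norm_feature_le_one hk hk1 _) (hD i) (norm_nonneg _) zero_le_one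
        _ = D := one_mul D
    rw [← Real.sqrt_sq hD0, ← Real.sqrt_mul (by positivity)]
    apply Real.abs_le_sqrt
    refine (Finset.sum_mul_sq_le_sq_mul_sq Finset.univ _ _).trans ?_
    have h1 : ∑ i, w i ^ 2 ≤ 1 / lam := by
      have h2 : ∑ i, w i ^ 2 = w ⬝ᵥ w := by simp [dotProduct, sq]
      rw [h2, le_div_iff₀ hlam]
      nlinarith [sq_nonneg ‖φ z - ∑ i, w i • φ (a i)‖]
    have h3 : ∑ i, inner ℝ (φ (a i)) (f i - g) ^ 2 ≤ n * D ^ 2 := by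
      calc ∑ i, inner ℝ (φ (a i)) (f i - g) ^ 2 ≤ ∑ _i : Fin n, D ^ 2 :=
            Finset.sum_le_sum fun i _ => sq_le_sq' (abs_le.1 (hterm i)).1 (abs_le.1 (hterm i)).2
        _ = n * D ^ 2 := by simp
    calc (∑ i, w i ^ 2) * ∑ i, inner ℝ (φ (a i)) (f i - g) ^ 2
        ≤ (1 / lam) * (n * D ^ 2) :=
          mul_le_mul h1 h3 (Finset.sum_nonneg fun i _ => sq_nonneg _) (by positivity)
      _ = n / lam * D ^ 2 := by ring
  rw [hdec]
  calc |inner ℝ (φ z - ∑ i, w i • φ (a i)) g - (∑ i, w i * inner ℝ (φ (a i)) (f i - g)) - v ⬝ᵥ w|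
      ≤ |inner ℝ (φ z - ∑ i, w i • φ (a i)) g| + |∑ i, w i * inner ℝ (φ (a i)) (f i - g)|
        + |v ⬝ᵥ w| := (abs_sub _ _).trans (by gcongr; exact abs_sub _ _)
    _ ≤ B * postStd k lam a z + √(n / lam) * D + √(noiseQuad k lam a v / lam) * postStd k lam a z
        := by gcongr
    _ = _ := by ring

/-! ### The mixture of exponentials and the excess of the confidence width -/

/-- The density `exp (Q / 2) / √det (I + K / λ)` that arises as the average of
`exp (∑ (v_i g(a_i) - g(a_i)² / 2))` over a Gaussian process `g` with kernel `k / λ`. -/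
noncomputable def mixture (k : X → X → ℝ) (lam : ℝ) {n : ℕ} (a : Fin n → X) (v : Fin n → ℝ) : ℝ :=
  Real.exp (noiseQuad k lam a v / 2 - infoGain k lam a)

theorem mixture_pos (a : Fin n → X) (v : Fin n → ℝ) : 0 < mixture k lam a v := Real.exp_pos _

/-- The confidence width may be too small, but its defect, multiplied by the posterior standard
deviation, is at most the fraction `δ` of the mixture, up to a factor of order `√(γ_n / n)`.
Where the posterior variance is not of order `γ_n / n`, the information gain is smaller than
`γ_n`, so the width is wider than necessary, and the two effects balance. -/
theorem width_defect_le (hk : ∀ x y, k x y = inner ℝ (φ x) (φ y))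
    (hlam : 0 < lam) (hk1 : ∀ z, k z z ≤ 1) (hn : 1 ≤ n) (hg : 1 ≤ maxInfoGain k lam n)
    {B R δ : ℝ} (hR : 0 ≤ R) (hδ : 0 < δ) (hδ1 : δ < 1) (a : Fin n → X) (v : Fin n → ℝ) (z : X) :
    (B + √(noiseQuad k lam a (R • v) / lam) - beta k lam B R δ n) * postStd k lam a z ≤
      Real.exp (1 + 1 / (2 * lam)) * (R * (δ * mixture k lam a v)) *
        √(maxInfoGain k lam n / n) := by
  set g := maxInfoGain k lam n with hgdef
  set L := Real.log (1 / δ) with hL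
  set q := noiseQuad k lam a v with hq
  set V := postVar k lam a z with hV
  set c := Real.exp (1 + 1 / (2 * lam)) with hc
  set M := mixture k lam a v with hM
  have hM0 : 0 < M := mixture_pos a v
  have hc0 : 0 < c := Real.exp_pos _
  have hn0 : (0 : ℝ) < n := by exact_mod_cast hn
  have hg0 : 0 < g := by linarith
  have hV0 : 0 ≤ V := postVar_nonneg hk hlam a z
  have hL0 : 0 ≤ L := Real.log_nonneg (by rw [le_div_iff₀ hδ]; linarith)
  set u := n / g * (V / lam) with hu
  have hu0 : 0 ≤ u := by positivity
  have hgap : infoGain k lam a + (1 / 2 : ℝ) * Real.log (1 + u) ≤ g + (1 + 1 / (2 * lam)) :=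
    infoGain_add_log_le_maxInfoGain hk hlam hk1 hn hg a z
  set s := √(1 + u) with hs
  have hs0 : 0 < s := by positivity
  set t := M * c * δ / s with ht
  have ht0 : 0 < t := by positivity
  have hqle : q ≤ 2 * g + 2 * L + 2 * t := by
    have h1 : Real.log t = (q / 2 - infoGain k lam a) + (1 + 1 / (2 * lam)) - L
        - (1 / 2) * Real.log (1 + u) := by
      rw [ht, Real.log_div (by positivity) hs0.ne', Real.log_mul (by positivity) hδ.ne',
        Real.log_mul hM0.ne' hc0.ne', hM, mixture, Real.log_exp, hc, Real.log_exp, hL,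
        one_div δ, Real.log_inv, hs, Real.log_sqrt (by positivity)]
      ring
    have h2 := Real.log_le_sub_one_of_pos ht0
    linarith
  set β := √(2 * g + 2 * L) with hβ
  have hβ1 : 1 ≤ β := Real.one_le_sqrt.2 (by linarith)
  have hsqrt : √q ≤ β + t := by
    apply Real.sqrt_le_iff.2
    refine ⟨by positivity, ?_⟩
    have : β ^ 2 = 2 * g + 2 * L := Real.sq_sqrt (by positivity)
    nlinarith
  have hwidth : B + √(noiseQuad k lam a (R • v) / lam) - beta k lam B R δ n =
      R / √lam * (√q - β) := by
    rw [noiseQuad_smul, ← hq, Real.sqrt_div' _ hlam.le, Real.sqrt_mul (sq_nonneg R),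
      Real.sqrt_sq hR, beta, ← hgdef, ← hL, ← hβ]
    ring
  have hsl : 0 < √lam := Real.sqrt_pos.2 hlam
  have hstd : postStd k lam a z ≤ √lam * √(g / n) * s := by
    rw [postStd, ← Real.sqrt_mul hlam.le, hs, ← Real.sqrt_mul (by positivity)]
    apply Real.sqrt_le_sqrt
    have : lam * (g / n) * (1 + u) = lam * (g / n) + V := by
      rw [hu]; field_simp
    rw [← hV, this]
    have : 0 ≤ lam * (g / n) := by positivity
    linarith
  have hstd0 : 0 ≤ postStd k lam a z := Real.sqrt_nonneg _
  rw [hwidth]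
  calc R / √lam * (√q - β) * postStd k lam a z ≤ R / √lam * t * postStd k lam a z := by
        gcongr; linarith
    _ ≤ R / √lam * t * (√lam * √(g / n) * s) := by gcongr
    _ = c * (R * (δ * M)) * √(g / n) := by rw [ht]; field_simp

/-! ### One-step recursion of the mixture -/

theorem noiseQuad_succ (hk : ∀ x y, k x y = inner ℝ (φ x) (φ y)) (hlam : 0 < lam)
    (x : ℕ → X) (v : ℕ → ℝ) (n : ℕ) :
    noiseQuad k lam (fun i : Fin (n + 1) => x i) (fun i : Fin (n + 1) => v i) =
      noiseQuad k lam (fun i : Fin n => x i) (fun i : Fin n => v i) + (v n ^ 2 -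
        (v n - postMean k lam (fun i : Fin n => x i) (fun i : Fin n => v i) (x n)) ^ 2 /
          (1 + postVar k lam (fun i : Fin n => x i) (x n) / lam)) := by
  set a : Fin n → X := fun i => x i with ha
  set b : Fin n → ℝ := fun i => v i with hb
  set V := postVar k lam a (x n) with hV
  set m := postMean k lam a b (x n) with hm
  set w := postWeight k lam a (x n) with hw
  set u := (kernMat k a + lam • (1 : Matrix (Fin n) (Fin n) ℝ))⁻¹ *ᵥ b with hu
  have hV0 : 0 ≤ V := postVar_nonneg hk hlam _ _
  have hVl : lam + V ≠ 0 := by positivity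
  set α := (v n - m) / (lam + V) with hα
  have hbu : kernMat k a *ᵥ u + lam • u = b := regularised_mulVec_inv hk hlam a b
  have hkw : kernMat k a *ᵥ w + lam • w = kernVec k a (x n) := regularised_mulVec_inv hk hlam a _
  have hm1 : m = kernVec k a (x n) ⬝ᵥ u := rfl
  have hm2 : m = b ⬝ᵥ w := postMean_eq_dotProduct hk hlam a b _
  have hVw : V = k (x n) (x n) - kernVec k a (x n) ⬝ᵥ w := rfl
  have hsolve : kernMat k (fun i : Fin (n + 1) => x i) *ᵥ (Fin.snoc (u - α • w) α) +
      lam • (Fin.snoc (u - α • w) α : Fin (n + 1) → ℝ) = fun i : Fin (n + 1) => v i := by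
    ext i
    refine Fin.lastCases ?_ (fun i => ?_) i
    · have h1 : (kernMat k (fun i : Fin (n + 1) => x i) *ᵥ (Fin.snoc (u - α • w) α)) (Fin.last n) =
          kernVec k a (x n) ⬝ᵥ (u - α • w) + k (x n) (x n) * α := by
        simp [mulVec, dotProduct, Fin.sum_univ_castSucc, kernMat, kernVec, ha,
          kern_comm hk (x n)]
      rw [Pi.add_apply, h1, dotProduct_sub, dotProduct_smul, ← hm1]
      simp only [Pi.smul_apply, Fin.snoc_last, smul_eq_mul, Fin.val_last]
      have : α * (lam + V) = v n - m := div_mul_cancel₀ _ hVl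
      rw [hVw] at this
      linarith
    · have h1 : (kernMat k (fun i : Fin (n + 1) => x i) *ᵥ (Fin.snoc (u - α • w) α)) i.castSucc =
          (kernMat k a *ᵥ (u - α • w)) i + kernVec k a (x n) i * α := by
        simp [mulVec, dotProduct, Fin.sum_univ_castSucc, kernMat, kernVec, ha]
      have h2 := congrFun hbu i
      have h3 := congrFun hkw i
      rw [Pi.add_apply, h1, mulVec_sub, mulVec_smul]
      simp only [Pi.smul_apply, Pi.add_apply, Pi.sub_apply, Fin.snoc_castSucc, smul_eq_mul,
        Fin.val_castSucc] at h2 h3 ⊢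
      rw [← h3]
      change _ = b i
      rw [← h2]
      ring
  have hinv := inv_mulVec_eq_of_solves hk hlam _ hsolve
  have hq : noiseQuad k lam a b = b ⬝ᵥ b - lam * (b ⬝ᵥ u) := rfl
  have hdot : (fun i : Fin (n + 1) => v i) ⬝ᵥ (Fin.snoc (u - α • w) α : Fin (n + 1) → ℝ) =
      b ⬝ᵥ (u - α • w) + v n * α := by
    simp [dotProduct, Fin.sum_univ_castSucc, hb]
  have hvv : (fun i : Fin (n + 1) => v i) ⬝ᵥ (fun i : Fin (n + 1) => v i) =
      b ⬝ᵥ b + v n * v n := by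
    simp [dotProduct, Fin.sum_univ_castSucc, hb]
  rw [noiseQuad, hinv, hdot, hvv, hq, dotProduct_sub, dotProduct_smul, ← hm2, hα]
  have h1 : 1 + V / lam = (lam + V) / lam := by field_simp
  rw [h1, smul_eq_mul]
  field_simp
  ring

/-- The mixture is updated by the Gaussian average of a single exponential, whose mean and
variance are those of the posterior. -/
theorem mixture_succ (hk : ∀ x y, k x y = inner ℝ (φ x) (φ y)) (hlam : 0 < lam)
    (x : ℕ → X) (v : ℕ → ℝ) (n : ℕ) :
    mixture k lam (fun i : Fin (n + 1) => x i) (fun i : Fin (n + 1) => v i) =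
      mixture k lam (fun i : Fin n => x i) (fun i : Fin n => v i) *
        ((√(1 + postVar k lam (fun i : Fin n => x i) (x n) / lam))⁻¹ * Real.exp ((v n ^ 2 -
          (v n - postMean k lam (fun i : Fin n => x i) (fun i : Fin n => v i) (x n)) ^ 2 /
            (1 + postVar k lam (fun i : Fin n => x i) (x n) / lam)) / 2)) := by
  have hV0 : 0 ≤ postVar k lam (fun i : Fin n => x i) (x n) / lam :=
    div_nonneg (postVar_nonneg hk hlam _ _) hlam.le
  have hI : infoGain k lam (fun i : Fin (n + 1) => x i) = infoGain k lam (fun i : Fin n => x i) +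
      Real.log (√(1 + postVar k lam (fun i : Fin n => x i) (x n) / lam)) := by
    rw [infoGain_eq_sum hk hlam, Finset.sum_range_succ, ← infoGain_eq_sum hk hlam,
      Real.log_sqrt (by positivity)]
    ring
  rw [mixture, noiseQuad_succ hk hlam, hI, mixture, ← Real.exp_log (show
    0 < (√(1 + postVar k lam (fun i : Fin n => x i) (x n) / lam))⁻¹ by positivity), Real.log_inv,
    ← Real.exp_add, ← Real.exp_add]
  congr 1
  ring

end Noise

/-! ### The mixture has expectation at most one -/

section Gaussian

/-- Gaussian average of `exp (r g - g² / 2)` over `g = m + s ξ`, by completing the square. -/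
theorem lintegral_exp_mul_gaussianPDF (r m s : ℝ) :
    ∫⁻ ξ, ENNReal.ofReal (Real.exp ((m + s * ξ) * r - (m + s * ξ) ^ 2 / 2)) *
        ProbabilityTheory.gaussianPDF 0 1 ξ =
      ENNReal.ofReal ((√(1 + s ^ 2))⁻¹ *
        Real.exp ((r ^ 2 - (r - m) ^ 2 / (1 + s ^ 2)) / 2)) := by
  have hD : 0 < 1 + s ^ 2 := by positivity
  set v : NNReal := ⟨(1 + s ^ 2)⁻¹, by positivity⟩ with hv
  have hvr : (v : ℝ) = (1 + s ^ 2)⁻¹ := rfl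
  have hv0 : v ≠ 0 := by
    intro h
    have := congrArg NNReal.toReal h
    rw [hvr] at this
    exact (inv_pos.2 hD).ne' this
  set c := (r - m) * s / (1 + s ^ 2) with hc
  have hpt : ∀ ξ, ENNReal.ofReal (Real.exp ((m + s * ξ) * r - (m + s * ξ) ^ 2 / 2)) *
        ProbabilityTheory.gaussianPDF 0 1 ξ =
      ENNReal.ofReal ((√(1 + s ^ 2))⁻¹ *
        Real.exp ((r ^ 2 - (r - m) ^ 2 / (1 + s ^ 2)) / 2)) *
        ProbabilityTheory.gaussianPDF c v ξ := by
    intro ξ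
    rw [ProbabilityTheory.gaussianPDF, ProbabilityTheory.gaussianPDF,
      ← ENNReal.ofReal_mul (by positivity), ← ENNReal.ofReal_mul (by positivity)]
    congr 1
    rw [ProbabilityTheory.gaussianPDFReal, ProbabilityTheory.gaussianPDFReal, hvr]
    have h1 : √(2 * Real.pi * (1 + s ^ 2)⁻¹) = √(2 * Real.pi) * (√(1 + s ^ 2))⁻¹ := by
      rw [Real.sqrt_mul (by positivity), Real.sqrt_inv]
    have hs : 0 < √(1 + s ^ 2) := by positivity
    have hp : 0 < √(2 * Real.pi) := by positivity
    have h2 : (m + s * ξ) * r - (m + s * ξ) ^ 2 / 2 + -(ξ - 0) ^ 2 / (2 * ((1 : NNReal) : ℝ)) =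
        (r ^ 2 - (r - m) ^ 2 / (1 + s ^ 2)) / 2 + -(ξ - c) ^ 2 / (2 * (1 + s ^ 2)⁻¹) := by
      rw [hc]
      push_cast
      field_simp
      ring
    have h3 := congrArg Real.exp h2
    rw [Real.exp_add, Real.exp_add] at h3
    rw [h1]
    simp only [NNReal.coe_one, mul_one] at h3 ⊢
    rw [mul_inv, inv_inv, mul_left_comm, h3]
    generalize Real.exp ((r ^ 2 - (r - m) ^ 2 / (1 + s ^ 2)) / 2) = e₁
    generalize Real.exp (-(ξ - c) ^ 2 / (2 * (1 + s ^ 2)⁻¹)) = e₂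
    field_simp
  simp_rw [hpt]
  rw [lintegral_const_mul _ (ProbabilityTheory.measurable_gaussianPDF c v),
    ProbabilityTheory.lintegral_gaussianPDF_eq_one c hv0, mul_one]

end Gaussian

section SubGaussian

variable {Ω : Type*} {m mΩ : MeasurableSpace Ω} {μ : Measure Ω} {ξ : Ω → ℝ}

/-- `ξ` is conditionally `1`-sub-Gaussian given the σ-algebra `m`, expressed by integrals over the
events of `m`. -/
def SubGaussianGiven (m : MeasurableSpace Ω) {mΩ : MeasurableSpace Ω} (μ : Measure Ω)
    (ξ : Ω → ℝ) : Prop :=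
  ∀ θ : ℝ, ∀ A, MeasurableSet[m] A →
    ∫⁻ ω in A, ENNReal.ofReal (Real.exp (θ * ξ ω - θ ^ 2 / 2)) ∂μ ≤ μ A

theorem SubGaussianGiven.lintegral_const_le (hm : m ≤ mΩ) (hξ : Measurable ξ)
    (h : SubGaussianGiven m μ ξ) (θ : ℝ) {Z : Ω → ENNReal} (hZ : Measurable[m] Z) :
    ∫⁻ ω, Z ω * ENNReal.ofReal (Real.exp (θ * ξ ω - θ ^ 2 / 2)) ∂μ ≤ ∫⁻ ω, Z ω ∂μ := by
  have hg : Measurable fun ω => ENNReal.ofReal (Real.exp (θ * ξ ω - θ ^ 2 / 2)) := by fun_prop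
  have h1 : ∫⁻ ω, Z ω * ENNReal.ofReal (Real.exp (θ * ξ ω - θ ^ 2 / 2)) ∂μ =
      ∫⁻ ω, Z ω ∂(μ.withDensity fun ω => ENNReal.ofReal (Real.exp (θ * ξ ω - θ ^ 2 / 2))) := by
    rw [lintegral_withDensity_eq_lintegral_mul _ hg (hZ.mono hm le_rfl)]
    simp [mul_comm]
  rw [h1, ← lintegral_trim hm hZ, ← lintegral_trim hm hZ]
  refine lintegral_mono' ?_ le_rfl
  refine Measure.le_iff.2 fun A hA => ?_
  rw [trim_measurableSet_eq hm hA, trim_measurableSet_eq hm hA, withDensity_apply _ (hm A hA)]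
  exact h θ A hA

theorem SubGaussianGiven.lintegral_finite_le (hm : m ≤ mΩ) (hξ : Measurable ξ)
    (h : SubGaussianGiven m μ ξ) {g : Ω → ℝ} (hg : Measurable[m] g) (S : Finset ℝ)
    (hS : ∀ ω, g ω ∈ S) {Z : Ω → ENNReal} (hZ : Measurable[m] Z) :
    ∫⁻ ω, Z ω * ENNReal.ofReal (Real.exp (g ω * ξ ω - g ω ^ 2 / 2)) ∂μ ≤ ∫⁻ ω, Z ω ∂μ := by
  classical
  have hset : ∀ c, MeasurableSet[m] (g ⁻¹' {c}) := fun c => hg (measurableSet_singleton c)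
  have hsplit : ∀ ω, Z ω = ∑ c ∈ S, (g ⁻¹' {c}).indicator Z ω := by
    intro ω
    rw [Finset.sum_eq_single (g ω)]
    · simp
    · intro c _ hc
      exact Set.indicator_of_notMem (by simpa using hc.symm) _
    · intro hc
      exact absurd (hS ω) hc
  have hmeas : ∀ c, Measurable[m] ((g ⁻¹' {c}).indicator Z) := fun c => hZ.indicator (hset c)
  have hE : ∀ c : ℝ, Measurable fun ω => ENNReal.ofReal (Real.exp (c * ξ ω - c ^ 2 / 2)) := by
    intro c; fun_prop
  calc ∫⁻ ω, Z ω * ENNReal.ofReal (Real.exp (g ω * ξ ω - g ω ^ 2 / 2)) ∂μ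
      = ∫⁻ ω, ∑ c ∈ S, (g ⁻¹' {c}).indicator Z ω *
          ENNReal.ofReal (Real.exp (c * ξ ω - c ^ 2 / 2)) ∂μ := by
        refine lintegral_congr fun ω => ?_
        conv_lhs => rw [hsplit ω]
        rw [Finset.sum_mul]
        refine Finset.sum_congr rfl fun c _ => ?_
        by_cases hc : g ω = c
        · rw [hc]
        · rw [Set.indicator_of_notMem (by simpa using hc), zero_mul, zero_mul]
    _ = ∑ c ∈ S, ∫⁻ ω, (g ⁻¹' {c}).indicator Z ω *
          ENNReal.ofReal (Real.exp (c * ξ ω - c ^ 2 / 2)) ∂μ :=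
        lintegral_finsetSum _ fun c _ => ((hmeas c).mono hm le_rfl).mul (hE c)
    _ ≤ ∑ c ∈ S, ∫⁻ ω, (g ⁻¹' {c}).indicator Z ω ∂μ :=
        Finset.sum_le_sum fun c _ => h.lintegral_const_le hm hξ c (hmeas c)
    _ = ∫⁻ ω, Z ω ∂μ := by
        rw [← lintegral_finsetSum _ fun c _ => (hmeas c).mono hm le_rfl]
        exact lintegral_congr fun ω => (hsplit ω).symm

/-- The sub-Gaussian bound extends to random parameters that are known beforehand. -/
theorem SubGaussianGiven.lintegral_le (hm : m ≤ mΩ) (hξ : Measurable ξ)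
    (h : SubGaussianGiven m μ ξ) {g : Ω → ℝ} (hg : Measurable[m] g) {Z : Ω → ENNReal}
    (hZ : Measurable[m] Z) :
    ∫⁻ ω, Z ω * ENNReal.ofReal (Real.exp (g ω * ξ ω - g ω ^ 2 / 2)) ∂μ ≤ ∫⁻ ω, Z ω ∂μ := by
  have hsm : StronglyMeasurable[m] g := hg.stronglyMeasurable
  have hZ' : Measurable Z := hZ.mono hm le_rfl
  have hlim : ∀ ω, Filter.Tendsto (fun n => ENNReal.ofReal (Real.exp
      (hsm.approx n ω * ξ ω - hsm.approx n ω ^ 2 / 2))) Filter.atTop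
      (nhds (ENNReal.ofReal (Real.exp (g ω * ξ ω - g ω ^ 2 / 2)))) := by
    intro ω
    have h1 := hsm.tendsto_approx ω
    exact ENNReal.tendsto_ofReal ((Real.continuous_exp.tendsto _).comp
      ((h1.mul_const _).sub ((h1.pow 2).div_const 2)))
  have hmeas : ∀ n, Measurable fun ω => Z ω * ENNReal.ofReal (Real.exp
      (hsm.approx n ω * ξ ω - hsm.approx n ω ^ 2 / 2)) := by
    intro n
    have h1 : Measurable fun ω => hsm.approx n ω :=
      (@SimpleFunc.measurable Ω ℝ m _ (hsm.approx n)).mono hm le_rfl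
    fun_prop
  calc ∫⁻ ω, Z ω * ENNReal.ofReal (Real.exp (g ω * ξ ω - g ω ^ 2 / 2)) ∂μ
      = ∫⁻ ω, Filter.liminf (fun n => Z ω * ENNReal.ofReal (Real.exp
          (hsm.approx n ω * ξ ω - hsm.approx n ω ^ 2 / 2))) Filter.atTop ∂μ := by
        refine lintegral_congr fun ω => (Filter.Tendsto.liminf_eq ?_).symm
        refine ENNReal.Tendsto.const_mul (hlim ω) (Or.inl ?_)
        simp [Real.exp_pos]
    _ ≤ Filter.liminf (fun n => ∫⁻ ω, Z ω * ENNReal.ofReal (Real.exp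
          (hsm.approx n ω * ξ ω - hsm.approx n ω ^ 2 / 2)) ∂μ) Filter.atTop :=
        lintegral_liminf_le hmeas
    _ ≤ Filter.liminf (fun _ : ℕ => ∫⁻ ω, Z ω ∂μ) Filter.atTop :=
        Filter.liminf_le_liminf
          (Filter.Eventually.of_forall fun n => h.lintegral_finite_le hm hξ
            (@SimpleFunc.measurable Ω ℝ m _ (hsm.approx n)) (@SimpleFunc.range Ω ℝ m (hsm.approx n))
            (@SimpleFunc.mem_range_self Ω ℝ m (hsm.approx n)) hZ)
    _ = ∫⁻ ω, Z ω ∂μ := by simp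

end SubGaussian

section Measurability

variable {X Ω : Type*} [MeasurableSpace X] {mΩ : MeasurableSpace Ω} {k : X → X → ℝ} {lam : ℝ} {n : ℕ}

theorem measurable_matrix_det {ι : Type*} [Fintype ι] [DecidableEq ι] {A : Ω → Matrix ι ι ℝ}
    (hA : ∀ i j, Measurable fun ω => A ω i j) : Measurable fun ω => (A ω).det := by
  simp only [det_apply]
  exact Finset.measurable_sum _ fun σ _ =>
    (Finset.measurable_prod _ fun i _ => hA _ _).const_smul _

theorem measurable_matrix_inv {ι : Type*} [Fintype ι] [DecidableEq ι] {A : Ω → Matrix ι ι ℝ}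
    (hA : ∀ i j, Measurable fun ω => A ω i j) (i j : ι) : Measurable fun ω => (A ω)⁻¹ i j := by
  have hadj : Measurable fun ω => (A ω).adjugate i j := by
    simp only [adjugate_apply]
    refine measurable_matrix_det fun p q => ?_
    by_cases hp : p = j
    · subst hp; simp
    · simpa [updateRow_ne hp] using hA p q
  simp only [Matrix.inv_def, Ring.inverse_eq_inv', Matrix.smul_apply, smul_eq_mul]
  exact (measurable_matrix_det hA).inv.mul hadj

theorem measurable_regularised_inv {a : Fin n → Ω → X}
    (hk : Measurable fun p : X × X => k p.1 p.2) (ha : ∀ i, Measurable (a i)) (i j : Fin n) :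
    Measurable fun ω =>
      (kernMat k (fun l => a l ω) + lam • (1 : Matrix (Fin n) (Fin n) ℝ))⁻¹ i j := by
  refine measurable_matrix_inv (fun p q => ?_) i j
  simp only [Matrix.add_apply, kernMat, of_apply]
  exact (hk.comp ((ha p).prodMk (ha q))).add_const _

theorem measurable_infoGain {a : Fin n → Ω → X} (hk : Measurable fun p : X × X => k p.1 p.2)
    (ha : ∀ i, Measurable (a i)) : Measurable fun ω => infoGain k lam (fun l => a l ω) := by
  refine (Real.measurable_log.comp (measurable_matrix_det fun p q => ?_)).const_mul _
  simp only [Matrix.add_apply, kernMat, Matrix.smul_apply, of_apply]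
  exact ((hk.comp ((ha p).prodMk (ha q))).const_mul _).const_add _

theorem measurable_noiseQuad {a : Fin n → Ω → X} {v : Fin n → Ω → ℝ}
    (hk : Measurable fun p : X × X => k p.1 p.2)
    (ha : ∀ i, Measurable (a i)) (hv : ∀ i, Measurable (v i)) :
    Measurable fun ω => noiseQuad k lam (fun l => a l ω) (fun l => v l ω) := by
  have h1 := measurable_regularised_inv (lam := lam) hk ha
  simp only [noiseQuad, mulVec, dotProduct]
  exact (Finset.measurable_sum _ fun i _ => (hv i).mul (hv i)).sub
    ((Finset.measurable_sum _ fun i _ => (hv i).mul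
      (Finset.measurable_sum _ fun j _ => (h1 i j).mul (hv j))).const_mul lam)

theorem measurable_mixture {a : Fin n → Ω → X} {v : Fin n → Ω → ℝ}
    (hk : Measurable fun p : X × X => k p.1 p.2)
    (ha : ∀ i, Measurable (a i)) (hv : ∀ i, Measurable (v i)) :
    Measurable fun ω => mixture k lam (fun l => a l ω) (fun l => v l ω) := by
  have h1 := measurable_noiseQuad (lam := lam) hk ha hv
  have h2 := measurable_infoGain (lam := lam) hk ha
  simp only [mixture]
  fun_prop

theorem measurable_postMean {a : Fin n → Ω → X} {v : Fin n → Ω → ℝ} {z : Ω → X}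
    (hk : Measurable fun p : X × X => k p.1 p.2)
    (ha : ∀ i, Measurable (a i)) (hv : ∀ i, Measurable (v i)) (hz : Measurable z) :
    Measurable fun ω => postMean k lam (fun l => a l ω) (fun l => v l ω) (z ω) := by
  have h1 := measurable_regularised_inv (lam := lam) hk ha
  have h2 : ∀ i, Measurable fun ω => k (a i ω) (z ω) := fun i => hk.comp ((ha i).prodMk hz)
  simp only [postMean, kernVec, mulVec, dotProduct]
  exact Finset.measurable_sum _ fun i _ => (h2 i).mul
    (Finset.measurable_sum _ fun j _ => (h1 i j).mul (hv j))

theorem measurable_postVar {a : Fin n → Ω → X} {z : Ω → X}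
    (hk : Measurable fun p : X × X => k p.1 p.2)
    (ha : ∀ i, Measurable (a i)) (hz : Measurable z) :
    Measurable fun ω => postVar k lam (fun l => a l ω) (z ω) := by
  have h1 := measurable_regularised_inv (lam := lam) hk ha
  have h2 : ∀ i, Measurable fun ω => k (a i ω) (z ω) := fun i => hk.comp ((ha i).prodMk hz)
  have h3 : Measurable fun ω => k (z ω) (z ω) := hk.comp (hz.prodMk hz)
  simp only [postVar, kernVec, mulVec, dotProduct]
  exact h3.sub (Finset.measurable_sum _ fun i _ => (h2 i).mul
    (Finset.measurable_sum _ fun j _ => (h1 i j).mul (h2 j)))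

end Measurability

section Supermartingale

variable {X E Ω : Type*} [NormedAddCommGroup E] [InnerProductSpace ℝ E] [MeasurableSpace X]
  {mΩ : MeasurableSpace Ω} {k : X → X → ℝ} {φ : X → E} {lam : ℝ}

/-- Method of mixtures: for queries chosen from the past and conditionally sub-Gaussian noise, the
mixture has expectation at most `1`. -/
theorem lintegral_mixture_le_one (hk : ∀ x y, k x y = inner ℝ (φ x) (φ y)) (hlam : 0 < lam)
    (hkm : Measurable fun p : X × X => k p.1 p.2) (μ : Measure Ω) [IsProbabilityMeasure μ]
    (𝓗 : ℕ → MeasurableSpace Ω) (h𝓗 : ∀ s, 𝓗 s ≤ mΩ) {x : ℕ → Ω → X} {ξ : ℕ → Ω → ℝ}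
    (hξ : ∀ s, Measurable (ξ s)) (hxm : ∀ r s, r ≤ s → Measurable[𝓗 s] (x r))
    (hξm : ∀ r s, r < s → Measurable[𝓗 s] (ξ r)) (n : ℕ)
    (hsub : ∀ s < n, SubGaussianGiven (𝓗 s) μ (ξ s)) :
    ∫⁻ ω, ENNReal.ofReal (mixture k lam (fun i : Fin n => x i ω) (fun i : Fin n => ξ i ω)) ∂μ
      ≤ 1 := by
  induction n with
  | zero => simp [mixture, noiseQuad, infoGain_fin_zero]
  | succ n ih =>
    set M : Ω → ENNReal := fun ω =>
      ENNReal.ofReal (mixture k lam (fun i : Fin n => x i ω) (fun i : Fin n => ξ i ω)) with hM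
    set p : Ω → ℝ := fun ω =>
      postMean k lam (fun i : Fin n => x i ω) (fun i : Fin n => ξ i ω) (x n ω) with hp
    set σ : Ω → ℝ := fun ω => √(postVar k lam (fun i : Fin n => x i ω) (x n ω) / lam) with hσ
    have hMm : Measurable[𝓗 n] M :=
      (measurable_mixture (Ω := Ω) hkm (fun i : Fin n => hxm i n i.2.le)
        (fun i : Fin n => hξm i n i.2)).ennreal_ofReal
    have hpm : Measurable[𝓗 n] p :=
      measurable_postMean (Ω := Ω) hkm (fun i : Fin n => hxm i n i.2.le)
        (fun i : Fin n => hξm i n i.2) (hxm n n le_rfl)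
    have hσm : Measurable[𝓗 n] σ :=
      ((measurable_postVar (Ω := Ω) hkm (fun i : Fin n => hxm i n i.2.le)
        (hxm n n le_rfl)).div_const lam).sqrt
    have hM' : Measurable M := hMm.mono (h𝓗 n) le_rfl
    have hp' : Measurable p := hpm.mono (h𝓗 n) le_rfl
    have hσ' : Measurable σ := hσm.mono (h𝓗 n) le_rfl
    have hstep : ∀ ω, ENNReal.ofReal (mixture k lam (fun i : Fin (n + 1) => x i ω)
          (fun i : Fin (n + 1) => ξ i ω)) =
        ∫⁻ t, M ω * (ENNReal.ofReal (Real.exp ((p ω + σ ω * t) * ξ n ω -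
          (p ω + σ ω * t) ^ 2 / 2)) * ProbabilityTheory.gaussianPDF 0 1 t) := by
      intro ω
      have hV : 0 ≤ postVar k lam (fun i : Fin n => x i ω) (x n ω) / lam :=
        div_nonneg (postVar_nonneg hk hlam _ _) hlam.le
      have hσ2 : σ ω ^ 2 = postVar k lam (fun i : Fin n => x i ω) (x n ω) / lam :=
        Real.sq_sqrt hV
      have hgm : Measurable fun t : ℝ => ENNReal.ofReal (Real.exp ((p ω + σ ω * t) * ξ n ω -
          (p ω + σ ω * t) ^ 2 / 2)) * ProbabilityTheory.gaussianPDF 0 1 t :=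
        Measurable.mul (by fun_prop) (ProbabilityTheory.measurable_gaussianPDF 0 1)
      rw [mixture_succ hk hlam (fun i => x i ω) (fun i => ξ i ω) n,
        lintegral_const_mul _ hgm, lintegral_exp_mul_gaussianPDF,
        ENNReal.ofReal_mul (mixture_pos _ _).le, hσ2]
    have hpdf := ProbabilityTheory.measurable_gaussianPDF 0 1
    calc ∫⁻ ω, ENNReal.ofReal (mixture k lam (fun i : Fin (n + 1) => x i ω)
          (fun i : Fin (n + 1) => ξ i ω)) ∂μ
        = ∫⁻ ω, ∫⁻ t, M ω * (ENNReal.ofReal (Real.exp ((p ω + σ ω * t) * ξ n ω -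
          (p ω + σ ω * t) ^ 2 / 2)) * ProbabilityTheory.gaussianPDF 0 1 t) ∂volume ∂μ :=
          lintegral_congr hstep
      _ = ∫⁻ t, ∫⁻ ω, M ω * (ENNReal.ofReal (Real.exp ((p ω + σ ω * t) * ξ n ω -
          (p ω + σ ω * t) ^ 2 / 2)) * ProbabilityTheory.gaussianPDF 0 1 t) ∂μ ∂volume := by
          refine lintegral_lintegral_swap (Measurable.aemeasurable ?_)
          have := hξ n
          fun_prop
      _ ≤ ∫⁻ t, (∫⁻ ω, M ω ∂μ) * ProbabilityTheory.gaussianPDF 0 1 t := by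
          refine lintegral_mono fun t => ?_
          have hg : Measurable[𝓗 n] fun ω => p ω + σ ω * t := hpm.add (hσm.mul_const t)
          have hle := (hsub n (Nat.lt_succ_self n)).lintegral_le (h𝓗 n) (hξ n) hg hMm
          have hξn := hξ n
          simp_rw [← mul_assoc]
          rw [lintegral_mul_const _ (by fun_prop)]
          gcongr
      _ = ∫⁻ ω, M ω ∂μ := by
          rw [lintegral_const_mul _ hpdf,
            ProbabilityTheory.lintegral_gaussianPDF_eq_one 0 one_ne_zero, mul_one]
      _ ≤ 1 := ih fun s hs => hsub s (hs.trans (Nat.lt_succ_self n))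

end Supermartingale

/-! ### The noise of a run -/

section Noise

variable {Ω : Type*} {m mΩ : MeasurableSpace Ω} {μ : Measure Ω} {η : Ω → ℝ} {R : ℝ}

theorem setLIntegral_exp_le [IsProbabilityMeasure μ] (hm : m ≤ mΩ) {θ : ℝ}
    (hint : Integrable (fun ω => Real.exp (θ * η ω)) μ)
    (hce : μ[fun ω => Real.exp (θ * η ω) | m] ≤ᵐ[μ] fun _ => Real.exp (θ ^ 2 * R ^ 2 / 2))
    {A : Set Ω} (hA : MeasurableSet[m] A) :
    ∫⁻ ω in A, ENNReal.ofReal (Real.exp (θ * η ω)) ∂μ ≤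
      ENNReal.ofReal (Real.exp (θ ^ 2 * R ^ 2 / 2)) * μ A := by
  rw [← ofReal_integral_eq_lintegral_ofReal hint.integrableOn
    (Filter.Eventually.of_forall fun ω => (Real.exp_pos _).le), ← setIntegral_condExp hm hint hA]
  have h1 : ∫ ω in A, (μ[fun ω => Real.exp (θ * η ω) | m]) ω ∂μ ≤
      ∫ _ in A, Real.exp (θ ^ 2 * R ^ 2 / 2) ∂μ :=
    setIntegral_mono_ae integrable_condExp.integrableOn (integrable_const _).integrableOn hce
  refine (ENNReal.ofReal_le_ofReal h1).trans ?_
  rw [setIntegral_const, smul_eq_mul, mul_comm, ENNReal.ofReal_mul (Real.exp_pos _).le,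
    ofReal_measureReal]

/-- The normalised noise is conditionally `1`-sub-Gaussian. For `R = 0` the quotient is `0`. -/
theorem subGaussianGiven_div [IsProbabilityMeasure μ] (hm : m ≤ mΩ) (hR : 0 ≤ R)
    (hint : ∀ θ : ℝ, Integrable (fun ω => Real.exp (θ * η ω)) μ)
    (hce : ∀ θ : ℝ, μ[fun ω => Real.exp (θ * η ω) | m] ≤ᵐ[μ]
      fun _ => Real.exp (θ ^ 2 * R ^ 2 / 2)) :
    SubGaussianGiven m μ fun ω => η ω / R := by
  intro θ A hA
  rcases hR.eq_or_lt with h0 | hpos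
  · rw [← h0]
    calc ∫⁻ ω in A, ENNReal.ofReal (Real.exp (θ * (η ω / 0) - θ ^ 2 / 2)) ∂μ
        ≤ ∫⁻ _ in A, 1 ∂μ := by
          refine lintegral_mono fun ω => ?_
          rw [ENNReal.ofReal_le_one, div_zero, mul_zero, zero_sub, Real.exp_le_one_iff]
          nlinarith [sq_nonneg θ]
      _ = μ A := by simp
  · have h := setLIntegral_exp_le hm (hint (θ / R)) (hce (θ / R)) hA
    have h1 : (θ / R) ^ 2 * R ^ 2 / 2 = θ ^ 2 / 2 := by field_simp
    rw [h1] at h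
    calc ∫⁻ ω in A, ENNReal.ofReal (Real.exp (θ * (η ω / R) - θ ^ 2 / 2)) ∂μ
        = ∫⁻ ω in A, ENNReal.ofReal (Real.exp (-(θ ^ 2 / 2))) *
            ENNReal.ofReal (Real.exp (θ / R * η ω)) ∂μ := by
          refine lintegral_congr fun ω => ?_
          rw [← ENNReal.ofReal_mul (Real.exp_pos _).le, ← Real.exp_add]
          congr 2
          ring
      _ = ENNReal.ofReal (Real.exp (-(θ ^ 2 / 2))) *
            ∫⁻ ω in A, ENNReal.ofReal (Real.exp (θ / R * η ω)) ∂μ :=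
          lintegral_const_mul' _ _ ENNReal.ofReal_ne_top
      _ ≤ ENNReal.ofReal (Real.exp (-(θ ^ 2 / 2))) *
            (ENNReal.ofReal (Real.exp (θ ^ 2 / 2)) * μ A) := by gcongr
      _ = μ A := by
          rw [← mul_assoc, ← ENNReal.ofReal_mul (Real.exp_pos _).le, ← Real.exp_add]
          simp

/-- Noise that is sub-Gaussian with parameter `0` vanishes, so that the noise is `R` times the
normalised noise also for `R = 0`. -/
theorem ae_eq_mul_div [IsProbabilityMeasure μ] (hm : m ≤ mΩ)
    (hint : ∀ θ : ℝ, Integrable (fun ω => Real.exp (θ * η ω)) μ)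
    (hce : ∀ θ : ℝ, μ[fun ω => Real.exp (θ * η ω) | m] ≤ᵐ[μ]
      fun _ => Real.exp (θ ^ 2 * R ^ 2 / 2)) :
    ∀ᵐ ω ∂μ, η ω = R * (η ω / R) := by
  by_cases h0 : R = 0
  · subst h0
    have hle : ∀ θ : ℝ, ∫ ω, Real.exp (θ * η ω) ∂μ ≤ 1 := by
      intro θ
      rw [← integral_condExp hm]
      calc ∫ ω, (μ[fun ω => Real.exp (θ * η ω) | m]) ω ∂μ
          ≤ ∫ _, Real.exp (θ ^ 2 * 0 ^ 2 / 2) ∂μ :=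
            integral_mono_ae integrable_condExp (integrable_const _) (hce θ)
        _ = 1 := by simp
    have hi : Integrable (fun ω => Real.exp (1 * η ω) + Real.exp (-1 * η ω) - 2) μ :=
      ((hint 1).add (hint (-1))).sub (integrable_const 2)
    have hsq : ∀ ω, Real.exp (1 * η ω) + Real.exp (-1 * η ω) - 2 =
        (Real.exp (η ω / 2) - Real.exp (-(η ω / 2))) ^ 2 := by
      intro ω
      have h1 : Real.exp (1 * η ω) = Real.exp (η ω / 2) ^ 2 := by
        rw [← Real.exp_nat_mul]; congr 1; push_cast; ring
      have h2 : Real.exp (-1 * η ω) = Real.exp (-(η ω / 2)) ^ 2 := by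
        rw [← Real.exp_nat_mul]; congr 1; push_cast; ring
      have h3 : Real.exp (η ω / 2) * Real.exp (-(η ω / 2)) = 1 := by
        rw [← Real.exp_add]; simp
      rw [h1, h2]
      linear_combination 2 * h3
    have hnn : 0 ≤ᵐ[μ] fun ω => Real.exp (1 * η ω) + Real.exp (-1 * η ω) - 2 :=
      Filter.Eventually.of_forall fun ω => by
        simp only [Pi.zero_apply]; rw [hsq]; exact sq_nonneg _
    have hzero : ∫ ω, (Real.exp (1 * η ω) + Real.exp (-1 * η ω) - 2) ∂μ = 0 := by
      refine le_antisymm ?_ (integral_nonneg_of_ae hnn)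
      have h1 : ∫ ω, (Real.exp (1 * η ω) + Real.exp (-1 * η ω) - 2) ∂μ =
          ∫ ω, Real.exp (1 * η ω) ∂μ + ∫ ω, Real.exp (-1 * η ω) ∂μ - 2 := by
        have h2 := integral_sub ((hint 1).add (hint (-1))) (integrable_const (μ := μ) (2 : ℝ))
        have h3 := integral_add (hint 1) (hint (-1))
        simp only [Pi.add_apply] at h2
        rw [h2, h3]
        simp
      have h4 := hle 1
      have h5 := hle (-1)
      rw [h1]
      linarith
    filter_upwards [(integral_eq_zero_iff_of_nonneg_ae hnn hi).1 hzero] with ω hω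
    simp only [Pi.zero_apply] at hω
    rw [hsq, sq_eq_zero_iff, sub_eq_zero, Real.exp_eq_exp] at hω
    linarith
  · exact Filter.Eventually.of_forall fun ω => by field_simp

end Noise

section Kernel

variable {X E : Type*} [NormedAddCommGroup E] [InnerProductSpace ℝ E] [CompleteSpace E]
  [RKHS ℝ E X ℝ]

/-- The feature map `z ↦ k(·, z)`. -/
noncomputable def feature (E : Type*) {X : Type*} [NormedAddCommGroup E] [InnerProductSpace ℝ E]
    [CompleteSpace E] [RKHS ℝ E X ℝ] (z : X) : E :=
  RKHS.kerFun E z 1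

theorem inner_feature (z : X) (f : E) : inner ℝ (feature E z) f = f z := by
  simp [feature]

theorem kern_eq_inner (x y : X) : kern E x y = inner ℝ (feature E x) (feature E y) := by
  rw [inner_feature, feature, RKHS.kerFun_apply, kern]

theorem continuous_feature [TopologicalSpace X]
    (hk : Continuous fun p : X × X => kern E p.1 p.2) : Continuous (feature E : X → E) := by
  rw [continuous_iff_continuousAt]
  intro z
  rw [ContinuousAt, tendsto_iff_norm_sub_tendsto_zero]
  have h1 : ∀ w, ‖feature E w - feature E z‖ =
      √(kern E w w - 2 * kern E w z + kern E z z) := by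
    intro w
    rw [kern_eq_inner, kern_eq_inner, kern_eq_inner, real_inner_self_eq_norm_sq,
      real_inner_self_eq_norm_sq, ← norm_sub_sq_real, Real.sqrt_sq (norm_nonneg _)]
  simp_rw [h1]
  have h2 : Continuous fun w => √(kern E w w - 2 * kern E w z + kern E z z) := by
    have ha : Continuous fun w => kern E w w :=
      hk.comp (f := fun w : X => (w, w)) (continuous_id.prodMk continuous_id)
    have hb : Continuous fun w => kern E w z :=
      hk.comp (f := fun w : X => (w, z)) (continuous_id.prodMk continuous_const)
    exact ((ha.sub (hb.const_mul 2)).add continuous_const).sqrt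
  have h3 := h2.tendsto z
  have h4 : kern E z z - 2 * kern E z z + kern E z z = 0 := by ring
  rwa [h4, Real.sqrt_zero] at h3

theorem continuous_rkhs [TopologicalSpace X]
    (hk : Continuous fun p : X × X => kern E p.1 p.2) (f : E) : Continuous fun z => f z := by
  simp_rw [← inner_feature]
  exact (continuous_feature hk).inner continuous_const

end Kernel

section History

variable {X Ω : Type*} [MeasurableSpace X] {x : ℕ → Ω → X}

theorem measurable_history_query {Y : ℕ → Ω → ℝ} {r s : ℕ} (hrs : r ≤ s) :
    Measurable[history x Y s] (x r) := by
  rw [measurable_iff_comap_le]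
  rcases hrs.eq_or_lt with rfl | hlt
  · exact le_sup_right
  · exact le_sup_of_le_left (le_iSup_of_le (⟨r, hlt⟩ : Fin s) le_sup_left)

theorem measurable_history_reward {Y : ℕ → Ω → ℝ} {r s : ℕ} (hrs : r < s) :
    Measurable[history x Y s] (Y r) := by
  rw [measurable_iff_comap_le]
  refine le_sup_of_le_left (le_iSup_of_le (⟨r, hrs⟩ : Fin s) ?_)
  rw [BorelSpace.measurable_eq (α := ℝ)]
  exact le_sup_right

end History

section Run

variable {X E Ω : Type*} [TopologicalSpace X] [MeasurableSpace X]
  [BorelSpace X] [NormedAddCommGroup E] [InnerProductSpace ℝ E] [CompleteSpace E] [RKHS ℝ E X ℝ]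
  {mΩ : MeasurableSpace Ω} {μ : Measure Ω} {f : ℕ → E} {x : ℕ → Ω → X} {η : ℕ → Ω → ℝ}
  {lam B R P δ : ℝ} {H T : ℕ}

theorem IsRun.measurable_reward (hk : Continuous fun p : X × X => kern E p.1 p.2)
    (h : IsRun E μ f x η lam B R P δ H T) (s : ℕ) : Measurable (reward f x η s) :=
  ((continuous_rkhs hk (f s)).measurable.comp (h.measurable_query s)).add (h.measurable_noise s)

theorem IsRun.history_le (hk : Continuous fun p : X × X => kern E p.1 p.2)
    (h : IsRun E μ f x η lam B R P δ H T) (s : ℕ) : history x (reward f x η) s ≤ mΩ := by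
  have hY : ∀ r, (borel ℝ).comap (reward f x η r) ≤ mΩ := by
    intro r
    rw [← BorelSpace.measurable_eq (α := ℝ)]
    exact (h.measurable_reward hk r).comap_le
  exact sup_le (iSup_le fun r => sup_le (h.measurable_query r).comap_le (hY r))
    (h.measurable_query s).comap_le

theorem measurable_history_noise (hk : Continuous fun p : X × X => kern E p.1 p.2)
    {r s : ℕ} (hrs : r < s) : Measurable[history x (reward f x η) s] (η r) := by
  have h1 : η r = fun ω => reward f x η r ω - f r (x r ω) := by
    ext ω; simp [reward]
  rw [h1]
  exact (measurable_history_reward hrs).sub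
    ((continuous_rkhs hk (f r)).measurable.comp (measurable_history_query hrs.le))

theorem IsRun.ae_noise_eq [IsProbabilityMeasure μ]
    (hk : Continuous fun p : X × X => kern E p.1 p.2)
    (h : IsRun E μ f x η lam B R P δ H T) :
    ∀ᵐ ω ∂μ, ∀ s < T, η s ω = R * (η s ω / R) := by
  rw [ae_all_iff]
  intro s
  by_cases hs : s < T
  · filter_upwards [ae_eq_mul_div (h.history_le hk s) (fun θ => (h.noise s hs θ).1)
      (fun θ => (h.noise s hs θ).2)] with ω hω _ using hω
  · exact Filter.Eventually.of_forall fun ω hs' => absurd hs' hs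

variable [SecondCountableTopology X]

/-- The mixture of any window of consecutive rounds has expectation at most `1`. -/
theorem IsRun.lintegral_mixture_le_one [IsProbabilityMeasure μ]
    (hk : Continuous fun p : X × X => kern E p.1 p.2) (hlam : 0 < lam) (hR : 0 ≤ R)
    (h : IsRun E μ f x η lam B R P δ H T) {s n : ℕ} (hsn : s + n ≤ T) :
    ∫⁻ ω, ENNReal.ofReal (mixture (kern E) lam (fun i : Fin n => x (s + i) ω)
      (fun i : Fin n => η (s + i) ω / R)) ∂μ ≤ 1 := by
  refine TVBO.lintegral_mixture_le_one (φ := feature E) kern_eq_inner hlam hk.measurable μ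
    (fun i => history x (reward f x η) (s + i)) (fun i => h.history_le hk (s + i))
    (x := fun i => x (s + i)) (ξ := fun i ω => η (s + i) ω / R) ?_ ?_ ?_ n ?_
  · exact fun i => (h.measurable_noise _).div_const R
  · exact fun r i hri => measurable_history_query (by omega)
  · exact fun r i hri => (measurable_history_noise hk (by omega)).div_const R
  · intro i hi
    exact subGaussianGiven_div (h.history_le hk (s + i)) hR
      (fun θ => (h.noise (s + i) (by omega) θ).1) (fun θ => (h.noise (s + i) (by omega) θ).2)

/-- With probability at least `1 - δ`, a positively weighted sum of the mixtures of all rounds is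
at most the sum of the weights divided by `δ`. -/
theorem IsRun.le_measureReal_mixture [IsProbabilityMeasure μ]
    (hk : Continuous fun p : X × X => kern E p.1 p.2) (hlam : 0 < lam) (hR : 0 ≤ R)
    (hδ : 0 < δ) (hT : 0 < T) (h : IsRun E μ f x η lam B R P δ H T) (w : ℕ → ℝ)
    (hw : ∀ s, 0 < w s) :
    1 - δ ≤ μ.real {ω | ∑ s ∈ Finset.range T, w s * mixture (kern E) lam
        (fun i : Fin (s % H) => x (s - s % H + i) ω)
        (fun i : Fin (s % H) => η (s - s % H + i) ω / R) ≤
      1 / δ * ∑ s ∈ Finset.range T, w s} := by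
  set M : ℕ → Ω → ℝ := fun s ω => mixture (kern E) lam
        (fun i : Fin (s % H) => x (s - s % H + i) ω)
        (fun i : Fin (s % H) => η (s - s % H + i) ω / R) with hM
  set K := ∑ s ∈ Finset.range T, w s with hK
  have hK0 : 0 < K := Finset.sum_pos (fun s _ => hw s) (by simp; omega)
  have hMm : ∀ s, Measurable (M s) := fun s =>
    measurable_mixture hk.measurable (fun i => h.measurable_query _)
      (fun i => (h.measurable_noise _).div_const R)
  have hSm : Measurable fun ω => ∑ s ∈ Finset.range T, w s * M s ω :=
    Finset.measurable_sum _ fun s _ => (hMm s).const_mul _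
  have hint : ∫⁻ ω, ENNReal.ofReal (∑ s ∈ Finset.range T, w s * M s ω) ∂μ ≤ ENNReal.ofReal K := by
    calc ∫⁻ ω, ENNReal.ofReal (∑ s ∈ Finset.range T, w s * M s ω) ∂μ
        = ∫⁻ ω, ∑ s ∈ Finset.range T, ENNReal.ofReal (w s) * ENNReal.ofReal (M s ω) ∂μ := by
          refine lintegral_congr fun ω => ?_
          rw [ENNReal.ofReal_sum_of_nonneg fun s _ =>
            mul_nonneg (hw s).le (mixture_pos _ _).le]
          exact Finset.sum_congr rfl fun s _ => ENNReal.ofReal_mul (hw s).le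
      _ = ∑ s ∈ Finset.range T, ENNReal.ofReal (w s) * ∫⁻ ω, ENNReal.ofReal (M s ω) ∂μ := by
          rw [lintegral_finsetSum _ fun s _ => ((hMm s).ennreal_ofReal).const_mul _]
          exact Finset.sum_congr rfl fun s _ =>
            lintegral_const_mul _ (hMm s).ennreal_ofReal
      _ ≤ ∑ s ∈ Finset.range T, ENNReal.ofReal (w s) * 1 := by
          refine Finset.sum_le_sum fun s hs => ?_
          gcongr
          refine h.lintegral_mixture_le_one hk hlam hR ?_
          have := Finset.mem_range.1 hs
          have := Nat.mod_le s H
          omega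
      _ = ENNReal.ofReal K := by
          rw [hK, ENNReal.ofReal_sum_of_nonneg fun s _ => (hw s).le]
          simp
  set G : Set Ω := {ω | ∑ s ∈ Finset.range T, w s * M s ω ≤ 1 / δ * K} with hG
  have hGm : MeasurableSet G := measurableSet_le hSm measurable_const
  have hbad : μ Gᶜ ≤ ENNReal.ofReal δ := by
    have hpos : 0 < 1 / δ * K := by positivity
    have h1 : μ Gᶜ ≤ μ {ω | ENNReal.ofReal (1 / δ * K) ≤
        ENNReal.ofReal (∑ s ∈ Finset.range T, w s * M s ω)} := by
      refine measure_mono fun ω hω => ?_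
      simp only [hG, Set.mem_compl_iff, Set.mem_ofPred_eq, not_le] at hω
      exact ENNReal.ofReal_le_ofReal hω.le
    refine h1.trans ((meas_ge_le_lintegral_div (hSm.ennreal_ofReal).aemeasurable
      (by simpa using hpos) ENNReal.ofReal_ne_top).trans ?_)
    calc _ ≤ ENNReal.ofReal K / ENNReal.ofReal (1 / δ * K) := by gcongr
      _ = ENNReal.ofReal δ := by
        rw [← ENNReal.ofReal_div_of_pos hpos]
        congr 1
        field_simp
  have hreal : μ.real Gᶜ ≤ δ := ENNReal.toReal_le_of_le_ofReal hδ.le hbad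
  rw [measureReal_compl hGm, probReal_univ] at hreal
  linarith

end Run

/-! ### The regret of one round -/

section Round

variable {X E : Type*} [NormedAddCommGroup E] [InnerProductSpace ℝ E]
  {k : X → X → ℝ} {φ : X → E} {lam : ℝ} {n : ℕ}

/-- Regret of a maximiser `p` of the upper confidence index. -/
theorem regret_le_of_ucb (hk : ∀ x y, k x y = inner ℝ (φ x) (φ y)) (hlam : 0 < lam)
    (hk1 : ∀ z, k z z ≤ 1) (hn : 1 ≤ n) (hγ : 1 ≤ maxInfoGain k lam n) {B R δ D b : ℝ}
    (hR : 0 ≤ R) (hδ : 0 < δ) (hδ1 : δ < 1) (a : Fin n → X) (f : Fin n → E) (g : E)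
    (hg : ‖g‖ ≤ B) (hD : ∀ i, ‖f i - g‖ ≤ D) (hD0 : 0 ≤ D) (u : Fin n → ℝ) (z p : X)
    (hb : beta k lam B R δ n ≤ b)
    (hsel : postMean k lam a (fun i => inner ℝ (φ (a i)) (f i) + R * u i) z +
        b * postStd k lam a z ≤
      postMean k lam a (fun i => inner ℝ (φ (a i)) (f i) + R * u i) p + b * postStd k lam a p) :
    inner ℝ (φ z) g - inner ℝ (φ p) g ≤ 2 * b * postStd k lam a p +
      2 * (Real.exp (1 + 1 / (2 * lam)) * (R * (δ * mixture k lam a u)) *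
        √(maxInfoGain k lam n / n)) + 2 * (√(n / lam) * D) := by
  have hz := abs_le.1 (abs_sub_postMean_le hk hlam hk1 a f g hg hD hD0 (R • u) z)
  have hp := abs_le.1 (abs_sub_postMean_le hk hlam hk1 a f g hg hD hD0 (R • u) p)
  have hwz := width_defect_le hk hlam hk1 hn hγ (B := B) hR hδ hδ1 a u z
  have hwp := width_defect_le hk hlam hk1 hn hγ (B := B) hR hδ hδ1 a u p
  simp only [Pi.smul_apply, smul_eq_mul] at hz hp
  have hsz : 0 ≤ postStd k lam a z := Real.sqrt_nonneg _
  have hsp : 0 ≤ postStd k lam a p := Real.sqrt_nonneg _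
  have h1 := mul_le_mul_of_nonneg_right hb hsz
  have h2 := mul_le_mul_of_nonneg_right hb hsp
  linarith [hz.2, hp.1]

/-- While the maximum information gain is below `1`, all feature vectors are so short that any
query has small regret. -/
theorem norm_feature_le (hk : ∀ x y, k x y = inner ℝ (φ x) (φ y)) (hlam : 0 < lam)
    (hk1 : ∀ z, k z z ≤ 1) (hn : 1 ≤ n) (hγ : maxInfoGain k lam n ≤ 1) (z : X) :
    ‖φ z‖ ≤ √(2 * Real.exp 2 * lam) * √(maxInfoGain k lam n / n) := by
  have h := mul_kern_le_of_maxInfoGain_le_one hk hlam hk1 hγ z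
  rw [hk, real_inner_self_eq_norm_sq] at h
  have hn0 : (0 : ℝ) < n := by exact_mod_cast hn
  rw [← Real.sqrt_mul (by positivity)]
  apply Real.le_sqrt_of_sq_le
  rw [← mul_div_assoc, le_div_iff₀ hn0]
  linarith

theorem inner_sub_inner_le {B c : ℝ} {g : E} (hg : ‖g‖ ≤ B) {z p : X} (hz : ‖φ z‖ ≤ c)
    (hp : ‖φ p‖ ≤ c) : inner ℝ (φ z) g - inner ℝ (φ p) g ≤ 2 * B * c := by
  have h1 := abs_le.1 (abs_real_inner_le_norm (φ z) g)
  have h2 := abs_le.1 (abs_real_inner_le_norm (φ p) g)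
  have hc := (norm_nonneg _).trans hz
  have hB := (norm_nonneg _).trans hg
  have h3 : ‖φ z‖ * ‖g‖ ≤ c * B := mul_le_mul hz hg (norm_nonneg _) hc
  have h4 : ‖φ p‖ * ‖g‖ ≤ c * B := mul_le_mul hp hg (norm_nonneg _) hc
  linarith [h1.2, h2.1]

theorem sum_postStd_le (hk : ∀ x y, k x y = inner ℝ (φ x) (φ y)) (hlam : 0 < lam)
    (hk1 : ∀ z, k z z ≤ 1) (x : ℕ → X) (H : ℕ) :
    ∑ i ∈ Finset.range H, postStd k lam (fun j : Fin i => x j) (x i) ≤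
      √H * √(2 * (1 + lam) * maxInfoGain k lam H) := by
  have hsq : ∑ i ∈ Finset.range H, postStd k lam (fun j : Fin i => x j) (x i) ^ 2 ≤
      2 * (1 + lam) * maxInfoGain k lam H := by
    have hI := infoGain_le_maxInfoGain hk hlam hk1 (fun i : Fin H => x i)
    have hterm : ∀ i, postStd k lam (fun j : Fin i => x j) (x i) ^ 2 ≤ 2 * (1 + lam) *
        ((1 / 2 : ℝ) * Real.log (1 + postVar k lam (fun j : Fin i => x j) (x i) / lam)) := by
      intro i
      set V := postVar k lam (fun j : Fin i => x j) (x i)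
      have hV0 : 0 ≤ V := postVar_nonneg hk hlam _ _
      have hV1 : V ≤ 1 := (postVar_le_kern hk hlam _ _).trans (hk1 _)
      have h1 := Real.one_sub_inv_le_log_of_pos (show 0 < 1 + V / lam by positivity)
      have h2 : 1 - (1 + V / lam)⁻¹ = V / (lam + V) := by field_simp; ring
      have h3 : V / (lam + 1) ≤ V / (lam + V) := by gcongr
      have h4 : V / (lam + 1) ≤ Real.log (1 + V / lam) := by linarith
      rw [div_le_iff₀ (by positivity)] at h4
      rw [postStd, Real.sq_sqrt hV0]
      linarith
    calc ∑ i ∈ Finset.range H, postStd k lam (fun j : Fin i => x j) (x i) ^ 2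
        ≤ ∑ i ∈ Finset.range H, 2 * (1 + lam) *
          ((1 / 2 : ℝ) * Real.log (1 + postVar k lam (fun j : Fin i => x j) (x i) / lam)) :=
          Finset.sum_le_sum fun i _ => hterm i
      _ = 2 * (1 + lam) * infoGain k lam (fun i : Fin H => x i) := by
          rw [infoGain_eq_sum hk hlam, Finset.mul_sum]
      _ ≤ _ := by gcongr
  rw [← Real.sqrt_mul (by positivity)]
  apply Real.le_sqrt_of_sq_le
  calc (∑ i ∈ Finset.range H, postStd k lam (fun j : Fin i => x j) (x i)) ^ 2
      ≤ H * ∑ i ∈ Finset.range H, postStd k lam (fun j : Fin i => x j) (x i) ^ 2 := by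
        simpa using sq_sum_le_card_mul_sum_sq (s := Finset.range H)
          (f := fun i => postStd k lam (fun j : Fin i => x j) (x i))
    _ ≤ _ := by gcongr

end Round

/-! ### Summation over blocks -/

section Blocks

theorem sum_range_mul_eq (g : ℕ → ℝ) (N H : ℕ) :
    ∑ s ∈ Finset.range (N * H), g s =
      ∑ b ∈ Finset.range N, ∑ i ∈ Finset.range H, g (b * H + i) := by
  induction N with
  | zero => simp
  | succ N ih => rw [Finset.sum_range_succ, ← ih, Nat.succ_mul, Finset.sum_range_add]

theorem sum_range_le_blocks {g : ℕ → ℝ} (hg : ∀ s, 0 ≤ g s) {T N H : ℕ} (hT : T ≤ N * H) :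
    ∑ s ∈ Finset.range T, g s ≤ ∑ b ∈ Finset.range N, ∑ i ∈ Finset.range H, g (b * H + i) := by
  rw [← sum_range_mul_eq]
  exact Finset.sum_le_sum_of_subset_of_nonneg (Finset.range_subset_range.2 hT) fun s _ _ => hg s

theorem sum_inv_sqrt_le (H : ℕ) :
    ∑ i ∈ Finset.range H, 1 / √((i : ℝ) + 1) ≤ 2 * √H := by
  induction H with
  | zero => simp
  | succ H ih =>
    rw [Finset.sum_range_succ]
    have h0 : 0 < √((H : ℝ) + 1) := by positivity
    have h1 : √(H : ℝ) ^ 2 = H := Real.sq_sqrt (by positivity)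
    have h2 : √((H : ℝ) + 1) ^ 2 = H + 1 := Real.sq_sqrt (by positivity)
    have h3 : 1 / √((H : ℝ) + 1) ≤ 2 * √((H : ℝ) + 1) - 2 * √(H : ℝ) := by
      rw [div_le_iff₀ h0]
      nlinarith [sq_nonneg (√((H : ℝ) + 1) - √(H : ℝ))]
    push_cast
    linarith

theorem sum_if_zero (H : ℕ) (hH : 1 ≤ H) :
    ∑ i ∈ Finset.range H, (if i = 0 then (1 : ℝ) else 0) = 1 := by
  rw [Finset.sum_ite_eq' (Finset.range H) 0 (fun _ => (1 : ℝ))]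
  simp; omega

end Blocks

section Variation

variable {E : Type*} [NormedAddCommGroup E]

/-- The variation `‖f_{s+1} - f_s‖` of the functions of the first `T` rounds. -/
noncomputable def stepVar (f : ℕ → E) (T s : ℕ) : ℝ :=
  if s + 1 < T then ‖f (s + 1) - f s‖ else 0

/-- The variation within the block of `H` rounds that contains the round `s`. -/
noncomputable def blockVar (f : ℕ → E) (H T s : ℕ) : ℝ :=
  ∑ r ∈ Finset.range H, stepVar f T (s / H * H + r)

theorem stepVar_nonneg (f : ℕ → E) (T s : ℕ) : 0 ≤ stepVar f T s := by
  unfold stepVar; split_ifs <;> positivity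

theorem blockVar_nonneg (f : ℕ → E) (H T s : ℕ) : 0 ≤ blockVar f H T s :=
  Finset.sum_nonneg fun _ _ => stepVar_nonneg _ _ _

theorem norm_sub_le_blockVar (f : ℕ → E) {H T s : ℕ} (hH : 1 ≤ H) (hs : s < T) (i : Fin (s % H)) :
    ‖f (s - s % H + i) - f s‖ ≤ blockVar f H T s := by
  have hi := i.2
  have hdiv := Nat.div_add_mod' s H
  have hmod := Nat.mod_lt s hH
  rw [← dist_eq_norm]
  refine (dist_le_Ico_sum_dist f (by omega : s - s % H + i ≤ s)).trans ?_
  have hle : ∑ r ∈ Finset.Ico (s - s % H + i) s, dist (f r) (f (r + 1)) =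
      ∑ r ∈ Finset.Ico (s - s % H + i) s, stepVar f T r := by
    refine Finset.sum_congr rfl fun r hr => ?_
    have := (Finset.mem_Ico.1 hr).2
    rw [stepVar, if_pos (by omega), dist_comm, dist_eq_norm]
  rw [hle, blockVar]
  have h2 : ∑ r ∈ Finset.range H, stepVar f T (s / H * H + r) =
      ∑ r ∈ Finset.Ico (s / H * H) (s / H * H + H), stepVar f T r := by
    rw [Finset.sum_Ico_eq_sum_range]
    congr 2
    omega
  rw [h2]
  refine Finset.sum_le_sum_of_subset_of_nonneg (fun r hr => ?_) fun r _ _ => stepVar_nonneg _ _ _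
  rw [Finset.mem_Ico] at hr ⊢
  omega

theorem sum_stepVar_eq (f : ℕ → E) {T M : ℕ} (hT : 1 ≤ T) (hM : T ≤ M) :
    ∑ s ∈ Finset.range M, stepVar f T s = ∑ s ∈ Finset.range (T - 1), ‖f (s + 1) - f s‖ := by
  rw [← Finset.sum_subset (Finset.range_subset_range.2 (by omega : T - 1 ≤ M))]
  · refine Finset.sum_congr rfl fun s hs => ?_
    have := Finset.mem_range.1 hs
    rw [stepVar, if_pos (by omega)]
  · intro s _ hs
    rw [Finset.mem_range] at hs
    rw [stepVar, if_neg (by omega)]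

end Variation

section Total

variable {X E : Type*} [NormedAddCommGroup E] [InnerProductSpace ℝ E]
  {k : X → X → ℝ} {φ : X → E} {lam : ℝ}

/-- The bound on the regret of a single round, in the form that is summed. -/
theorem round_regret_le [Nonempty X] (hk : ∀ x y, k x y = inner ℝ (φ x) (φ y)) (hlam : 0 < lam)
    (hk1 : ∀ z, k z z ≤ 1) {B R δ bmax : ℝ} {H T : ℕ} (hR : 0 ≤ R) (hδ : 0 < δ) (hδ1 : δ < 1)
    (hH : 1 ≤ H) (hγ : 1 ≤ maxInfoGain k lam H) (x : ℕ → X) (u y : ℕ → ℝ) (f : ℕ → E)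
    (b : ℕ → ℝ) (hf : ∀ s < T, ‖f s‖ ≤ B)
    (hy : ∀ s < T, y s = inner ℝ (φ (x s)) (f s) + R * u s)
    (hsel : SelectsUCB k lam b H T x y)
    (hb : ∀ n, beta k lam B R δ n ≤ b n) (hbmax : ∀ n ≤ H, b n ≤ bmax) (hbmax0 : 0 ≤ bmax)
    {s : ℕ} (hs : s < T) (z : X) :
    inner ℝ (φ z) (f s) - inner ℝ (φ (x s)) (f s) ≤
      2 * B * (if s % H = 0 then 1 else 0) +
      2 * B * √(4 * Real.exp 2 * lam) * √(maxInfoGain k lam H) * (1 / √((s % H : ℕ) + 1)) +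
      2 * bmax * postStd k lam (fun i : Fin (s % H) => x (s - s % H + i)) (x s) +
      2 * √2 * Real.exp (1 + 1 / (2 * lam)) * R * δ * √(maxInfoGain k lam H) *
        (1 / √((s % H : ℕ) + 1) * mixture k lam (fun i : Fin (s % H) => x (s - s % H + i))
          (fun i : Fin (s % H) => u (s - s % H + i))) +
      2 * √(H / lam) * blockVar f H T s := by
  set n := s % H with hn
  set g := maxInfoGain k lam H with hg
  set σ := postStd k lam (fun i : Fin n => x (s - n + i)) (x s) with hσ
  set M := mixture k lam (fun i : Fin n => x (s - n + i)) (fun i : Fin n => u (s - n + i)) with hM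
  set w := 1 / √((n : ℝ) + 1) with hw
  set D := blockVar f H T s with hD
  set c := Real.exp (1 + 1 / (2 * lam)) with hc
  have hnH : n ≤ H := (Nat.mod_lt s hH).le
  have hB : 0 ≤ B := (norm_nonneg _).trans (hf s hs)
  have hσ0 : 0 ≤ σ := Real.sqrt_nonneg _
  have hM0 : 0 < M := mixture_pos _ _
  have hw0 : 0 < w := by positivity
  have hD0 : 0 ≤ D := blockVar_nonneg _ _ _ _
  have hc0 : 0 < c := Real.exp_pos _
  have hg0 : 0 ≤ g := by linarith
  have t2 : 0 ≤ 2 * B * √(4 * Real.exp 2 * lam) * √g * w := by positivity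
  have t3 : 0 ≤ 2 * bmax * σ := by positivity
  have t4 : 0 ≤ 2 * √2 * c * R * δ * √g * (w * M) := by positivity
  have t5 : 0 ≤ 2 * √(H / lam) * D := by positivity
  rcases Nat.eq_zero_or_pos n with h0 | hpos
  · rw [if_pos h0]
    have := inner_sub_inner_le (hf s hs) (norm_feature_le_one hk hk1 z) (norm_feature_le_one hk hk1 (x s))
    linarith
  rw [if_neg hpos.ne', mul_zero, zero_add]
  have hn0 : (0 : ℝ) < n := by exact_mod_cast hpos
  -- `1 / n` is compared with `1 / (n + 1)`, which makes sense in the reset rounds as well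
  have hwn : ∀ r, 0 ≤ r → √(r / n) ≤ √2 * √r * w := by
    intro r hr
    rw [hw, mul_one_div, ← Real.sqrt_mul (by norm_num), ← Real.sqrt_div (by positivity)]
    apply Real.sqrt_le_sqrt
    rw [div_le_div_iff₀ hn0 (by positivity)]
    have : (1 : ℝ) ≤ n := by exact_mod_cast hpos
    nlinarith
  have hgn : maxInfoGain k lam n ≤ g := maxInfoGain_mono hk hlam hk1 hnH
  have hgn0 : 0 ≤ maxInfoGain k lam n := maxInfoGain_nonneg hk hlam n
  have hroot : √(maxInfoGain k lam n / n) ≤ √2 * √g * w :=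
    (hwn _ hgn0).trans (by gcongr)
  rcases le_total (maxInfoGain k lam n) 1 with hsmall | hlarge
  · have h1 := norm_feature_le hk hlam hk1 hpos hsmall z
    have h2 := norm_feature_le hk hlam hk1 hpos hsmall (x s)
    have h3 := inner_sub_inner_le (hf s hs) h1 h2
    have h4 : √(4 * Real.exp 2 * lam) = √(2 * Real.exp 2 * lam) * √2 := by
      rw [← Real.sqrt_mul (by positivity)]; congr 1; ring
    have h5 : 2 * B * (√(2 * Real.exp 2 * lam) * √(maxInfoGain k lam n / n)) ≤
        2 * B * √(4 * Real.exp 2 * lam) * √g * w := by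
      calc 2 * B * (√(2 * Real.exp 2 * lam) * √(maxInfoGain k lam n / n))
          ≤ 2 * B * (√(2 * Real.exp 2 * lam) * (√2 * √g * w)) := by gcongr
        _ = _ := by rw [h4]; ring
    linarith
  · have hsel' := hsel s hs z
    simp only [ucbIndex, ← hn, if_neg hpos.ne'] at hsel'
    have hyw : (fun i : Fin n => y (s - n + i)) = fun i : Fin n =>
        inner ℝ (φ (x (s - n + i))) (f (s - n + i)) + R * u (s - n + i) := by
      ext i
      exact hy _ (by have := i.2; have := Nat.mod_le s H; omega)
    rw [hyw] at hsel'
    have hmain := regret_le_of_ucb hk hlam hk1 hpos hlarge hR hδ hδ1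
      (fun i : Fin n => x (s - n + i)) (fun i : Fin n => f (s - n + i)) (f s) (hf s hs)
      (fun i => norm_sub_le_blockVar f hH hs i) hD0 (fun i : Fin n => u (s - n + i)) z (x s)
      (hb n) hsel'
    rw [← hσ, ← hM, ← hc] at hmain
    have h1 : 2 * b n * σ ≤ 2 * bmax * σ := by
      have := hbmax n hnH
      gcongr
    have h2 : 2 * (c * (R * (δ * M)) * √(maxInfoGain k lam n / n)) ≤
        2 * √2 * c * R * δ * √g * (w * M) := by
      calc 2 * (c * (R * (δ * M)) * √(maxInfoGain k lam n / n))
          ≤ 2 * (c * (R * (δ * M)) * (√2 * √g * w)) := by gcongr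
        _ = _ := by ring
    have h3 : 2 * (√(n / lam) * D) ≤ 2 * √(H / lam) * D := by
      rw [mul_assoc]
      gcongr
    linarith

theorem sum_weight_le {T N H : ℕ} (hT : T ≤ N * H) :
    ∑ s ∈ Finset.range T, 1 / √((s % H : ℕ) + 1 : ℝ) ≤ N * (2 * √H) := by
  refine (sum_range_le_blocks (fun s => by positivity) hT).trans ?_
  calc ∑ b ∈ Finset.range N, ∑ i ∈ Finset.range H, 1 / √(((b * H + i) % H : ℕ) + 1 : ℝ)
      ≤ ∑ _b ∈ Finset.range N, 2 * √H := by
        refine Finset.sum_le_sum fun b _ => le_trans (le_of_eq ?_) (sum_inv_sqrt_le H)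
        refine Finset.sum_congr rfl fun i hi => ?_
        rw [Nat.mul_add_mod_of_lt (Finset.mem_range.1 hi)]
    _ = N * (2 * √H) := by simp

theorem rpow_three_halves (H : ℕ) : (H : ℝ) ^ (3 / 2 : ℝ) = H * √H := by
  have h0 : (0 : ℝ) ≤ H := by positivity
  rw [show (3 / 2 : ℝ) = 1 + 1 / 2 by norm_num, Real.rpow_add' h0 (by norm_num), Real.rpow_one,
    Real.sqrt_eq_rpow]

/-- Regret of all rounds, on the event that the weighted sum of the mixtures is at most `1 / δ`
times its expected size. The factor `1 / δ` cancels against the factor `δ` in the defect of the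
confidence width. -/
theorem sum_regret_le [Nonempty X] (hk : ∀ x y, k x y = inner ℝ (φ x) (φ y)) (hlam : 0 < lam)
    (hk1 : ∀ z, k z z ≤ 1) {B R P δ bmax : ℝ} {H T : ℕ} (hR : 0 ≤ R) (hδ : 0 < δ) (hδ1 : δ < 1)
    (hH : 1 ≤ H) (hHT : H ≤ T) (hγ : 1 ≤ maxInfoGain k lam H) (x : ℕ → X) (u y : ℕ → ℝ)
    (f : ℕ → E) (b : ℕ → ℝ) (hf : ∀ s < T, ‖f s‖ ≤ B)
    (hvar : ∑ s ∈ Finset.range (T - 1), ‖f (s + 1) - f s‖ ≤ P)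
    (hy : ∀ s < T, y s = inner ℝ (φ (x s)) (f s) + R * u s)
    (hsel : SelectsUCB k lam b H T x y)
    (hb : ∀ n, beta k lam B R δ n ≤ b n) (hbmax : ∀ n ≤ H, b n ≤ bmax) (hbmax0 : 0 ≤ bmax)
    (hmix : ∑ s ∈ Finset.range T, 1 / √((s % H : ℕ) + 1 : ℝ) *
        mixture k lam (fun i : Fin (s % H) => x (s - s % H + i))
          (fun i : Fin (s % H) => u (s - s % H + i)) ≤
      1 / δ * ∑ s ∈ Finset.range T, 1 / √((s % H : ℕ) + 1 : ℝ))
    (r : ℕ → ℝ) (hr : ∀ s < T, ∀ c,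
      (∀ z, inner ℝ (φ z) (f s) - inner ℝ (φ (x s)) (f s) ≤ c) → r s ≤ c) :
    ∑ s ∈ Finset.range T, r s ≤
      (4 * B + 8 * B * √(4 * Real.exp 2 * lam) + 4 * bmax * √(2 * (1 + lam)) +
        8 * √2 * Real.exp (1 + 1 / (2 * lam)) * R) * (T * √(maxInfoGain k lam H / H)) +
      2 / √lam * ((H : ℝ) ^ (3 / 2 : ℝ) * P) := by
  set g := maxInfoGain k lam H with hg
  set c := Real.exp (1 + 1 / (2 * lam)) with hc
  set c₁ := √(4 * Real.exp 2 * lam) with hc₁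
  have hB : 0 ≤ B := (norm_nonneg _).trans (hf 0 (by omega))
  have hg0 : 0 ≤ g := by linarith
  have hc0 : 0 < c := Real.exp_pos _
  have hH0 : (0 : ℝ) < H := by exact_mod_cast hH
  have hH1 : (1 : ℝ) ≤ H := by exact_mod_cast hH
  have hsH : 0 < √(H : ℝ) := Real.sqrt_pos.2 hH0
  have hsHsq : √(H : ℝ) ^ 2 = H := Real.sq_sqrt hH0.le
  -- the number of blocks, the last of which may be incomplete
  set N := T / H + 1 with hN
  have hTN : T ≤ N * H := by
    have := Nat.div_add_mod' T H
    have := Nat.mod_lt T hH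
    rw [hN, Nat.succ_mul]; omega
  have hNH : (N : ℝ) * H ≤ 2 * T := by
    have h1 : N * H ≤ 2 * T := by
      have := Nat.div_mul_le_self T H
      rw [hN, Nat.succ_mul]; omega
    exact_mod_cast h1
  have hroot : √(g / H) = √g / √H := Real.sqrt_div' _ hH0.le
  have hNs : (N : ℝ) * √H ≤ 2 * T / √H := by
    rw [le_div_iff₀ hsH, mul_assoc, ← sq, hsHsq]
    exact hNH
  set G := (T : ℝ) * √(g / H) with hG
  have hNG : (N : ℝ) * √H * √g ≤ 2 * G := by
    calc (N : ℝ) * √H * √g ≤ 2 * T / √H * √g := by gcongr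
      _ = 2 * G := by rw [hG, hroot]; ring
  have hmod : ∀ b i, i ∈ Finset.range H → (b * H + i) % H = i := fun b i hi =>
    Nat.mul_add_mod_of_lt (Finset.mem_range.1 hi)
  have hdiv : ∀ b i, i ∈ Finset.range H → (b * H + i) / H = b := by
    intro b i hi
    rw [mul_comm, Nat.mul_add_div hH, Nat.div_eq_of_lt (Finset.mem_range.1 hi), add_zero]
  have s1 : ∑ s ∈ Finset.range T, 2 * B * (if s % H = 0 then (1 : ℝ) else 0) ≤ 4 * B * G := by
    have h1 : ∑ s ∈ Finset.range T, (if s % H = 0 then (1 : ℝ) else 0) ≤ N := by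
      refine (sum_range_le_blocks (fun s => by positivity) hTN).trans ?_
      calc ∑ b ∈ Finset.range N, ∑ i ∈ Finset.range H, (if (b * H + i) % H = 0 then (1 : ℝ) else 0)
          = ∑ _b ∈ Finset.range N, (1 : ℝ) := by
            refine Finset.sum_congr rfl fun b _ => ?_
            refine (Finset.sum_congr rfl fun i hi => ?_).trans (sum_if_zero H hH)
            rw [hmod b i hi]
        _ ≤ N := by simp
    have h2 : (N : ℝ) ≤ 2 * G := by
      refine le_trans ?_ hNG
      have h3 : 1 ≤ √(H : ℝ) := Real.one_le_sqrt.2 hH1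
      have h4 : 1 ≤ √g := Real.one_le_sqrt.2 hγ
      have h5 : 1 ≤ √(H : ℝ) * √g := one_le_mul_of_one_le_of_one_le h3 h4
      rw [mul_assoc]
      exact le_mul_of_one_le_right (by positivity) h5
    rw [← Finset.mul_sum]
    calc 2 * B * ∑ s ∈ Finset.range T, (if s % H = 0 then (1 : ℝ) else 0) ≤ 2 * B * (2 * G) := by
          gcongr; exact h1.trans h2
      _ = 4 * B * G := by ring
  have hw : √g * ∑ s ∈ Finset.range T, 1 / √((s % H : ℕ) + 1 : ℝ) ≤ 4 * G := by
    calc √g * ∑ s ∈ Finset.range T, 1 / √((s % H : ℕ) + 1 : ℝ) ≤ √g * (N * (2 * √H)) := by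
          gcongr; exact sum_weight_le hTN
      _ = 2 * (N * √H * √g) := by ring
      _ ≤ 4 * G := by linarith
  have s2 : ∑ s ∈ Finset.range T, 2 * B * c₁ * √g * (1 / √((s % H : ℕ) + 1 : ℝ)) ≤
      8 * B * c₁ * G := by
    rw [← Finset.mul_sum]
    calc 2 * B * c₁ * √g * ∑ s ∈ Finset.range T, 1 / √((s % H : ℕ) + 1 : ℝ)
        = 2 * B * c₁ * (√g * ∑ s ∈ Finset.range T, 1 / √((s % H : ℕ) + 1 : ℝ)) := by ring
      _ ≤ 2 * B * c₁ * (4 * G) := by gcongr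
      _ = _ := by ring
  have s3 : ∑ s ∈ Finset.range T,
      2 * bmax * postStd k lam (fun i : Fin (s % H) => x (s - s % H + i)) (x s) ≤
      4 * bmax * √(2 * (1 + lam)) * G := by
    set τ : ℕ → ℕ → ℝ := fun p n => postStd k lam (fun i : Fin n => x (p + i)) (x (p + n)) with hτ
    have h1 : ∀ s, postStd k lam (fun i : Fin (s % H) => x (s - s % H + i)) (x s) =
        τ (s - s % H) (s % H) := by
      intro s
      rw [hτ]
      simp only [Nat.sub_add_cancel (Nat.mod_le s H)]
    have h2 : ∑ s ∈ Finset.range T, τ (s - s % H) (s % H) ≤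
        N * (√H * √(2 * (1 + lam) * g)) := by
      refine (sum_range_le_blocks (g := fun s => τ (s - s % H) (s % H))
        (fun s => Real.sqrt_nonneg _) hTN).trans ?_
      calc ∑ b ∈ Finset.range N, ∑ i ∈ Finset.range H,
            τ (b * H + i - (b * H + i) % H) ((b * H + i) % H)
          ≤ ∑ _b ∈ Finset.range N, √H * √(2 * (1 + lam) * g) := by
            refine Finset.sum_le_sum fun b _ => ?_
            refine le_trans (le_of_eq ?_)
              (sum_postStd_le hk hlam hk1 (fun i => x (b * H + i)) H)
            refine Finset.sum_congr rfl fun i hi => ?_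
            rw [hmod b i hi, Nat.add_sub_cancel]
        _ = _ := by simp
    simp_rw [h1]
    rw [← Finset.mul_sum]
    calc 2 * bmax * ∑ s ∈ Finset.range T, τ (s - s % H) (s % H)
        ≤ 2 * bmax * (N * (√H * √(2 * (1 + lam) * g))) := by gcongr
      _ = 2 * bmax * √(2 * (1 + lam)) * (N * √H * √g) := by
          rw [Real.sqrt_mul (by positivity)]; ring
      _ ≤ 2 * bmax * √(2 * (1 + lam)) * (2 * G) := by gcongr
      _ = _ := by ring
  have s4 : ∑ s ∈ Finset.range T, 2 * √2 * c * R * δ * √g * (1 / √((s % H : ℕ) + 1 : ℝ) *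
        mixture k lam (fun i : Fin (s % H) => x (s - s % H + i))
          (fun i : Fin (s % H) => u (s - s % H + i))) ≤ 8 * √2 * c * R * G := by
    rw [← Finset.mul_sum]
    calc _ ≤ 2 * √2 * c * R * δ * √g *
          (1 / δ * ∑ s ∈ Finset.range T, 1 / √((s % H : ℕ) + 1 : ℝ)) := by gcongr
      _ = 2 * √2 * c * R * (√g * ∑ s ∈ Finset.range T, 1 / √((s % H : ℕ) + 1 : ℝ)) := by
          field_simp
      _ ≤ 2 * √2 * c * R * (4 * G) := by gcongr
      _ = _ := by ring
  have s5 : ∑ s ∈ Finset.range T, 2 * √(H / lam) * blockVar f H T s ≤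
      2 / √lam * ((H : ℝ) ^ (3 / 2 : ℝ) * P) := by
    have h1 : ∑ s ∈ Finset.range T, blockVar f H T s ≤ H * P := by
      refine (sum_range_le_blocks (fun s => blockVar_nonneg f H T s) hTN).trans ?_
      calc ∑ b ∈ Finset.range N, ∑ i ∈ Finset.range H, blockVar f H T (b * H + i)
          = ∑ b ∈ Finset.range N, H * ∑ r ∈ Finset.range H, stepVar f T (b * H + r) := by
            refine Finset.sum_congr rfl fun b _ => ?_
            have h2 : ∀ i ∈ Finset.range H, blockVar f H T (b * H + i) =
                ∑ r ∈ Finset.range H, stepVar f T (b * H + r) := by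
              intro i hi
              rw [blockVar, hdiv b i hi]
            rw [Finset.sum_congr rfl h2]
            simp
        _ = H * ∑ s ∈ Finset.range (N * H), stepVar f T s := by
            rw [← Finset.mul_sum, sum_range_mul_eq]
        _ ≤ H * P := by
            rw [sum_stepVar_eq f (hH.trans hHT) hTN]
            gcongr
    rw [← Finset.mul_sum, rpow_three_halves, Real.sqrt_div' _ hlam.le]
    calc 2 * (√(H : ℝ) / √lam) * ∑ s ∈ Finset.range T, blockVar f H T s
        ≤ 2 * (√(H : ℝ) / √lam) * (H * P) := by gcongr
      _ = _ := by ring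
  have hsum := Finset.sum_le_sum fun s (hs : s ∈ Finset.range T) =>
    hr s (Finset.mem_range.1 hs) _ fun z => round_regret_le hk hlam hk1 hR hδ hδ1 hH hγ x u y f b
      hf hy hsel hb hbmax hbmax0 (Finset.mem_range.1 hs) z
  refine hsum.trans ?_
  simp only [Finset.sum_add_distrib]
  rw [← hg, ← hc, ← hc₁]
  linarith

end Total

/-! ### The regret bound for a given reset interval -/

section Width

variable {X E : Type*} [NormedAddCommGroup E] [InnerProductSpace ℝ E]
  {k : X → X → ℝ} {φ : X → E} {lam B R δ : ℝ}

theorem le_beta (hR : 0 ≤ R) (n : ℕ) : B ≤ beta k lam B R δ n := by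
  have : 0 ≤ 1 / √lam * R * √(2 * maxInfoGain k lam n + 2 * Real.log (1 / δ)) := by positivity
  rw [beta]
  linarith

theorem beta_mono [Nonempty X] (hk : ∀ x y, k x y = inner ℝ (φ x) (φ y)) (hlam : 0 < lam)
    (hk1 : ∀ z, k z z ≤ 1) (hR : 0 ≤ R) {n H : ℕ} (hn : n ≤ H) :
    beta k lam B R δ n ≤ beta k lam B R δ H := by
  have := maxInfoGain_mono hk hlam hk1 hn
  unfold beta
  gcongr

theorem le_sqrt_mul_beta (hlam : 0 < lam) (hB : 0 ≤ B) (hR : 0 ≤ R) (hL : 0 ≤ Real.log (1 / δ))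
    {H : ℕ} (hγ : 1 ≤ maxInfoGain k lam H) : R ≤ √lam * beta k lam B R δ H := by
  have hs : 0 < √lam := Real.sqrt_pos.2 hlam
  have h1 : 1 ≤ √(2 * maxInfoGain k lam H + 2 * Real.log (1 / δ)) :=
    Real.one_le_sqrt.2 (by linarith)
  calc R ≤ R * √(2 * maxInfoGain k lam H + 2 * Real.log (1 / δ)) := le_mul_of_one_le_right hR h1
    _ = √lam * (1 / √lam * R * √(2 * maxInfoGain k lam H + 2 * Real.log (1 / δ))) := by
        field_simp
    _ ≤ √lam * beta k lam B R δ H := by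
        rw [beta]
        gcongr
        linarith

theorem beta_le_betaPlus (hlam : 1 ≤ lam) (hR : 0 ≤ R) (n : ℕ) :
    beta k lam B R δ n ≤ betaPlus k lam B R δ n := by
  have h1 : 1 / √lam ≤ 1 := by
    rw [div_le_one (by positivity)]
    exact Real.one_le_sqrt.2 hlam
  have h2 : √(2 * maxInfoGain k lam n + 2 * Real.log (1 / δ)) ≤
      √(2 * (maxInfoGain k lam n + 1 + Real.log (1 / δ))) := Real.sqrt_le_sqrt (by linarith)
  rw [beta, betaPlus]
  calc B + 1 / √lam * R * √(2 * maxInfoGain k lam n + 2 * Real.log (1 / δ))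
      ≤ B + 1 * R * √(2 * (maxInfoGain k lam n + 1 + Real.log (1 / δ))) := by gcongr
    _ = _ := by ring

theorem betaPlus_le [Nonempty X] (hk : ∀ x y, k x y = inner ℝ (φ x) (φ y)) (hlam : 0 < lam)
    (hk1 : ∀ z, k z z ≤ 1) (hB : 0 ≤ B) (hR : 0 ≤ R) (hL : 0 ≤ Real.log (1 / δ)) {n H : ℕ}
    (hn : n ≤ H) (hγ : 1 ≤ maxInfoGain k lam H) :
    betaPlus k lam B R δ n ≤ (1 + √(2 * lam)) * beta k lam B R δ H := by
  have hs : 0 < √lam := Real.sqrt_pos.2 hlam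
  have h1 := maxInfoGain_mono hk hlam hk1 hn
  have h2 : √(2 * (maxInfoGain k lam n + 1 + Real.log (1 / δ))) ≤
      √2 * √(2 * maxInfoGain k lam H + 2 * Real.log (1 / δ)) := by
    rw [← Real.sqrt_mul (by norm_num)]
    exact Real.sqrt_le_sqrt (by linarith)
  set S := √(2 * maxInfoGain k lam H + 2 * Real.log (1 / δ)) with hS
  have h3 : beta k lam B R δ H = B + 1 / √lam * R * S := rfl
  have h4 : B ≤ beta k lam B R δ H := le_beta hR H
  have h5 : 1 / √lam * R * S ≤ beta k lam B R δ H := by linarith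
  rw [betaPlus]
  calc B + R * √(2 * (maxInfoGain k lam n + 1 + Real.log (1 / δ))) ≤ B + R * (√2 * S) := by gcongr
    _ = B + √2 * √lam * (1 / √lam * R * S) := by field_simp
    _ ≤ beta k lam B R δ H + √2 * √lam * beta k lam B R δ H := by gcongr
    _ = _ := by rw [Real.sqrt_mul (by norm_num)]; ring

end Width

section Regret

variable {X E Ω : Type*} [NormedAddCommGroup E] [InnerProductSpace ℝ E] [CompleteSpace E]
  [RKHS ℝ E X ℝ]

theorem iSup_sub_le [Nonempty X] (g : E) (p : X) {c : ℝ}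
    (h : ∀ z, inner ℝ (feature E z) g - inner ℝ (feature E p) g ≤ c) :
    (⨆ z, g z) - g p ≤ c := by
  have h1 : ⨆ z, g z ≤ c + g p := ciSup_le fun z => by
    have := h z
    rw [inner_feature, inner_feature] at this
    linarith
  linarith

/-- The regret of arbitrary queries. -/
theorem dynRegret_le_of_norm_feature_le [Nonempty X] {f : ℕ → E} {T : ℕ} {B c : ℝ}
    (hf : ∀ s < T, ‖f s‖ ≤ B) (hc : ∀ z : X, ‖feature E z‖ ≤ c) (x : ℕ → X) :
    dynRegret f x T ≤ 2 * B * c * T := by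
  calc dynRegret f x T ≤ ∑ _s ∈ Finset.range T, 2 * B * c :=
        Finset.sum_le_sum fun s hs => iSup_sub_le _ _ fun z =>
          inner_sub_inner_le (hf s (Finset.mem_range.1 hs)) (hc z) (hc _)
    _ = 2 * B * c * T := by simp; ring

theorem one_sub_le_measureReal_of_forall {Ω : Type*} {mΩ : MeasurableSpace Ω} {μ : Measure Ω}
    [IsProbabilityMeasure μ] {δ : ℝ} (hδ : 0 < δ) {p : Ω → Prop}
    (h : ∀ ω, p ω) : 1 - δ ≤ μ.real {ω | p ω} := by
  have : {ω | p ω} = Set.univ := Set.eq_univ_of_forall h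
  rw [this, probReal_univ]
  linarith

/-- The constant of the regret bound for a given reset interval. -/
noncomputable def regretConst (lam : ℝ) : ℝ :=
  4 + 8 * √(4 * Real.exp 2 * lam) + 4 * (1 + √(2 * lam)) * √(2 * (1 + lam)) +
    8 * √2 * Real.exp (1 + 1 / (2 * lam)) * √lam + 2 / √lam + 2 * √(2 * Real.exp 2 * lam)

theorem regretConst_pos {lam : ℝ} (hlam : 0 < lam) : 0 < regretConst lam := by
  unfold regretConst
  positivity

variable [TopologicalSpace X] [SecondCountableTopology X] [MeasurableSpace X]
  [BorelSpace X] {mΩ : MeasurableSpace Ω} {μ : Measure Ω} {f : ℕ → E} {x : ℕ → Ω → X}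
  {η : ℕ → Ω → ℝ} {lam B R P δ : ℝ} {H T : ℕ}

theorem IsRun.le_measureReal_regret [Nonempty X] [IsProbabilityMeasure μ]
    (hk : Continuous fun p : X × X => kern E p.1 p.2) (hk1 : ∀ z : X, kern E z z ≤ 1)
    (hlam : 0 < lam) (hR : 0 ≤ R) (hδ : 0 < δ) (hδ1 : δ < 1) (hH : 1 ≤ H) (hHT : H ≤ T)
    (h : IsRun E μ f x η lam B R P δ H T) :
    1 - δ ≤ μ.real {ω | dynRegret f (fun s => x s ω) T ≤ regretConst lam *
      (√(maxInfoGain (kern E) lam H) * (H : ℝ) ^ (3 / 2 : ℝ) * P +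
        beta (kern E) lam B R δ H * T * √(maxInfoGain (kern E) lam H / H))} := by
  have hki : ∀ x y : X, kern E x y = inner ℝ (feature E x) (feature E y) := kern_eq_inner
  have hT : 0 < T := hH.trans hHT
  have hB : 0 ≤ B := (norm_nonneg _).trans (h.norm_le 0 hT)
  have hP : 0 ≤ P := le_trans (Finset.sum_nonneg fun _ _ => norm_nonneg _) h.variation_le
  have hL : 0 ≤ Real.log (1 / δ) := Real.log_nonneg (by rw [le_div_iff₀ hδ]; linarith)
  have hH0 : (0 : ℝ) < H := by exact_mod_cast hH
  set k : X → X → ℝ := kern E with hkdef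
  set g := maxInfoGain k lam H with hg
  have hg0 : 0 ≤ g := maxInfoGain_nonneg hki hlam H
  set β := beta k lam B R δ H with hβ
  have hBβ : B ≤ β := le_beta hR H
  have hβ0 : 0 ≤ β := hB.trans hBβ
  set G := (T : ℝ) * √(g / H) with hG
  have hG0 : 0 ≤ G := by positivity
  set Q := (H : ℝ) ^ (3 / 2 : ℝ) * P with hQ
  have hQ0 : 0 ≤ Q := by positivity
  have hbound : √g * (H : ℝ) ^ (3 / 2 : ℝ) * P + β * T * √(g / H) = √g * Q + β * G := by
    rw [hQ, hG]; ring
  rw [hbound]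
  rcases le_total g 1 with hsmall | hlarge
  · refine one_sub_le_measureReal_of_forall hδ fun ω => ?_
    refine (dynRegret_le_of_norm_feature_le h.norm_le
      (fun z => norm_feature_le hki hlam hk1 hH hsmall z) _).trans ?_
    calc 2 * B * (√(2 * Real.exp 2 * lam) * √(g / H)) * T
        = 2 * √(2 * Real.exp 2 * lam) * (B * G) := by rw [hG]; ring
      _ ≤ regretConst lam * (√g * Q + β * G) := by
          have h1 : 2 * √(2 * Real.exp 2 * lam) ≤ regretConst lam := by
            unfold regretConst
            have : 0 ≤ 4 + 8 * √(4 * Real.exp 2 * lam) + 4 * (1 + √(2 * lam)) *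
              √(2 * (1 + lam)) + 8 * √2 * Real.exp (1 + 1 / (2 * lam)) * √lam + 2 / √lam := by
              positivity
            linarith
          have h2 : B * G ≤ √g * Q + β * G := by
            have : B * G ≤ β * G := by gcongr
            have : 0 ≤ √g * Q := by positivity
            linarith
          exact mul_le_mul h1 h2 (by positivity) (regretConst_pos hlam).le
  have hRβ : R ≤ √lam * β := le_sqrt_mul_beta hlam hB hR hL hlarge
  -- on the event of the weighted mixtures, the deterministic bound applies almost surely
  have hprob := h.le_measureReal_mixture hk hlam hR hδ hT (fun s => 1 / √((s % H : ℕ) + 1 : ℝ))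
    (fun s => by positivity)
  refine hprob.trans (ENNReal.toReal_mono (measure_ne_top _ _) (measure_mono_ae ?_))
  filter_upwards [h.ae_noise_eq hk] with ω hω hmix
  have hmix' : ∑ s ∈ Finset.range T, 1 / √((s % H : ℕ) + 1 : ℝ) *
        mixture k lam (fun i : Fin (s % H) => x (s - s % H + i) ω)
          (fun i : Fin (s % H) => η (s - s % H + i) ω / R) ≤
      1 / δ * ∑ s ∈ Finset.range T, 1 / √((s % H : ℕ) + 1 : ℝ) := hmix
  obtain ⟨b, hsel, hb, hbmax⟩ : ∃ b : ℕ → ℝ,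
      SelectsUCB k lam b H T (fun s => x s ω) (fun s => reward f x η s ω) ∧
      (∀ n, beta k lam B R δ n ≤ b n) ∧ ∀ n ≤ H, b n ≤ (1 + √(2 * lam)) * β := by
    rcases h.select with hs | ⟨hl, hs⟩
    · refine ⟨_, hs ω, fun n => le_rfl, fun n hn => ?_⟩
      refine (beta_mono hki hlam hk1 hR hn).trans ?_
      exact le_mul_of_one_le_left hβ0 (by linarith [Real.sqrt_nonneg (2 * lam)])
    · exact ⟨_, hs ω, fun n => beta_le_betaPlus hl hR n,
        fun n hn => betaPlus_le hki hlam hk1 hB hR hL hn hlarge⟩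
  have hmain := sum_regret_le (P := P) hki hlam hk1 hR hδ hδ1 hH hHT hlarge (fun s => x s ω)
    (fun s => η s ω / R) (fun s => reward f x η s ω) f b h.norm_le h.variation_le
    (fun s hs => by rw [reward, inner_feature, ← hω s hs]) hsel hb hbmax (by positivity) hmix'
    (fun s => (⨆ z : X, f s z) - f s (x s ω))
    (fun s _ c hc => iSup_sub_le _ _ hc)
  change dynRegret f (fun s => x s ω) T ≤ regretConst lam * (√g * Q + β * G)
  refine hmain.trans ?_
  rw [← hg, ← hG, ← hQ]
  have hC := regretConst_pos hlam
  have hQg : Q ≤ √g * Q := le_mul_of_one_le_left hQ0 (Real.one_le_sqrt.2 hlarge)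
  set c := Real.exp (1 + 1 / (2 * lam)) with hc
  have hc0 : 0 < c := Real.exp_pos _
  set c₁ := √(4 * Real.exp 2 * lam) with hc₁
  set c₂ := 4 * (1 + √(2 * lam)) * √(2 * (1 + lam)) with hc₂
  have hfac : 4 * B + 8 * B * c₁ + 4 * ((1 + √(2 * lam)) * β) * √(2 * (1 + lam)) +
      8 * √2 * c * R ≤ (4 + 8 * c₁ + c₂ + 8 * √2 * c * √lam) * β := by
    calc 4 * B + 8 * B * c₁ + 4 * ((1 + √(2 * lam)) * β) * √(2 * (1 + lam)) + 8 * √2 * c * R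
        ≤ 4 * β + 8 * β * c₁ + 4 * ((1 + √(2 * lam)) * β) * √(2 * (1 + lam)) +
          8 * √2 * c * (√lam * β) := by gcongr
      _ = _ := by rw [hc₂]; ring
  have hle1 : 4 + 8 * c₁ + c₂ + 8 * √2 * c * √lam ≤ regretConst lam := by
    have : regretConst lam = 4 + 8 * c₁ + c₂ + 8 * √2 * c * √lam + 2 / √lam +
      2 * √(2 * Real.exp 2 * lam) := rfl
    have h1 : 0 ≤ 2 / √lam + 2 * √(2 * Real.exp 2 * lam) := by positivity
    linarith
  have hle2 : 2 / √lam ≤ regretConst lam := by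
    have : regretConst lam = 4 + 8 * c₁ + c₂ + 8 * √2 * c * √lam + 2 / √lam +
      2 * √(2 * Real.exp 2 * lam) := rfl
    have h1 : 0 ≤ 4 + 8 * c₁ + c₂ + 8 * √2 * c * √lam + 2 * √(2 * Real.exp 2 * lam) := by
      positivity
    linarith
  calc _ ≤ ((4 + 8 * c₁ + c₂ + 8 * √2 * c * √lam) * β) * G + 2 / √lam * Q := by gcongr
    _ ≤ (regretConst lam * β) * G + regretConst lam * (√g * Q) := by gcongr
    _ = regretConst lam * (√g * Q + β * G) := by ring

end Regret

/-! ### Tuning of the reset interval -/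

section Tuning

/-- A reset interval of order `γ^{1/4} (T / q)^{1/2}` balances the two terms of the regret bound,
unless the clamping to `[1, T]` is active; then `T` is so small that the trivial bound `T` on
the regret suffices. In terms of the roots `a = γ^{1/8}`, `τ = T^{1/4}`, `κ = q^{1/4}`, the
interval is `h = (a τ / κ)²`, and `W` is the factor that stands for the variation budget. -/
theorem tuning_dichotomy {a τ κ W P g₀ : ℝ} {T H : ℕ} (ha : 0 < a) (hτ : 0 < τ) (hκ : 1 ≤ κ)
    (hg₀ : 0 < g₀) (hag : g₀ ≤ a ^ 8) (hT : (T : ℝ) = τ ^ 4) (hW : κ ≤ W)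
    (hPW : P ≤ W * κ ^ 3) (hP : 0 ≤ P) (hH : H = max 1 (min T ⌈(a * τ / κ) ^ 2⌉₊)) :
    (T : ℝ) ≤ 2 * (1 + 1 / g₀) * (a ^ 7 * W * τ ^ 3) ∨
      (a ^ 4 * (H * √H) * P ≤ 4 * (a ^ 7 * W * τ ^ 3) ∧
        a ^ 4 * (T * (a ^ 4 / √H)) ≤ a ^ 7 * W * τ ^ 3) := by
  set h := (a * τ / κ) ^ 2 with hh
  have hκ0 : 0 < κ := by linarith
  have hW0 : 0 < W := by linarith
  have hW1 : 1 ≤ W := by linarith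
  have hroot0 : 0 < a * τ / κ := by positivity
  have ha8 : 0 < a ^ 8 := by positivity
  have hinv8 : 1 / a ^ 8 ≤ 1 / g₀ := one_div_le_one_div_of_le hg₀ hag
  have hg0' : 0 < 1 / g₀ := by positivity
  have hS : 0 < a ^ 7 * W * τ ^ 3 := by positivity
  by_cases h1 : h < 1
  · left
    have h2 : a * τ / κ < 1 := by
      by_contra hcon
      exact absurd h1 (not_lt.2 (one_le_pow₀ (not_lt.1 hcon)))
    rw [div_lt_one hκ0] at h2
    have h3 : (T : ℝ) ≤ 1 / a ^ 8 * (a ^ 7 * W * τ ^ 3) := by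
      rw [hT, one_div_mul_eq_div, le_div_iff₀ ha8]
      have h4 : a * τ ≤ W := by linarith
      calc τ ^ 4 * a ^ 8 = a ^ 7 * (a * τ) * τ ^ 3 := by ring
        _ ≤ a ^ 7 * W * τ ^ 3 := by gcongr
    calc (T : ℝ) ≤ 1 / a ^ 8 * (a ^ 7 * W * τ ^ 3) := h3
      _ ≤ 2 * (1 + 1 / g₀) * (a ^ 7 * W * τ ^ 3) := by gcongr; linarith
  have h1' : 1 ≤ h := not_lt.1 h1
  have hceil : (⌈h⌉₊ : ℝ) ≤ 2 * h := by
    have := Nat.ceil_lt_add_one (show 0 ≤ h by linarith)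
    linarith
  rcases Nat.lt_or_ge T ⌈h⌉₊ with hlt | hge
  · left
    have h2 : (T : ℝ) ≤ 2 * h := le_trans (by exact_mod_cast hlt.le) hceil
    rw [hT, hh, div_pow, mul_div_assoc', le_div_iff₀ (by positivity)] at h2
    have h3 : τ ^ 2 ≤ 2 * a ^ 2 := by
      have h4 : τ ^ 2 * τ ^ 2 ≤ (2 * a ^ 2) * τ ^ 2 := by
        calc τ ^ 2 * τ ^ 2 = τ ^ 4 * 1 := by ring
          _ ≤ τ ^ 4 * κ ^ 2 := by gcongr; exact one_le_pow₀ hκ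
          _ ≤ 2 * (a * τ) ^ 2 := h2
          _ = _ := by ring
      exact le_of_mul_le_mul_right h4 (by positivity)
    have h5 : τ ≤ 2 * a := by nlinarith
    have h6 : 1 ≤ (1 + 1 / g₀) * a ^ 6 := by
      have h7 : (1 + 1 / a ^ 8) * a ^ 6 ≤ (1 + 1 / g₀) * a ^ 6 := by gcongr
      refine le_trans ?_ h7
      have h8 : (1 + 1 / a ^ 8) * a ^ 6 = a ^ 6 + 1 / a ^ 2 := by field_simp
      rw [h8]
      rcases le_total 1 a with h9 | h9
      · have := one_le_pow₀ h9 (n := 6)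
        have : 0 ≤ 1 / a ^ 2 := by positivity
        linarith
      · have h10 : 1 ≤ 1 / a ^ 2 := by
          rw [le_div_iff₀ (by positivity), one_mul]
          exact pow_le_one₀ ha.le h9
        have : 0 ≤ a ^ 6 := by positivity
        linarith
    calc (T : ℝ) = τ * τ ^ 3 * 1 := by rw [hT]; ring
      _ ≤ 2 * a * τ ^ 3 * ((1 + 1 / g₀) * a ^ 6) := by gcongr
      _ = 2 * (1 + 1 / g₀) * (a ^ 7 * 1 * τ ^ 3) := by ring
      _ ≤ _ := by gcongr
  · right
    have hceil1 : 1 ≤ ⌈h⌉₊ := Nat.one_le_ceil_iff.2 (by linarith)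
    have hHc : H = ⌈h⌉₊ := by rw [hH, min_eq_right hge, max_eq_right hceil1]
    have hHlow : h ≤ H := by rw [hHc]; exact Nat.le_ceil h
    have hHup : (H : ℝ) ≤ 2 * h := by rw [hHc]; exact hceil
    have hslow : a * τ / κ ≤ √H := Real.le_sqrt_of_sq_le hHlow
    have hsup : √(H : ℝ) ≤ 2 * (a * τ / κ) := by
      rw [Real.sqrt_le_iff]
      refine ⟨by positivity, ?_⟩
      calc (H : ℝ) ≤ 2 * h := hHup
        _ ≤ 4 * h := by linarith
        _ = _ := by rw [hh]; ring
    constructor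
    · calc a ^ 4 * (H * √H) * P ≤ a ^ 4 * (2 * (a * τ / κ) ^ 2 * (2 * (a * τ / κ))) *
            (W * κ ^ 3) := by gcongr
        _ = 4 * (a ^ 7 * W * τ ^ 3) := by field_simp; ring
    · calc a ^ 4 * (T * (a ^ 4 / √H)) ≤ a ^ 4 * (τ ^ 4 * (a ^ 4 / (a * τ / κ))) := by
            rw [hT]; gcongr
        _ = a ^ 7 * κ * τ ^ 3 := by field_simp
        _ ≤ a ^ 7 * W * τ ^ 3 := by gcongr

theorem rpow_eighth {γ : ℝ} (hγ : 0 ≤ γ) : γ = (γ ^ (1 / 8 : ℝ)) ^ 8 ∧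
    √γ = (γ ^ (1 / 8 : ℝ)) ^ 4 ∧ γ ^ (7 / 8 : ℝ) = (γ ^ (1 / 8 : ℝ)) ^ 7 ∧
    γ ^ (1 / 4 : ℝ) = (γ ^ (1 / 8 : ℝ)) ^ 2 := by
  refine ⟨?_, ?_, ?_, ?_⟩
  · rw [← Real.rpow_mul_natCast hγ]; norm_num
  · rw [← Real.rpow_mul_natCast hγ, Real.sqrt_eq_rpow]; norm_num
  · rw [← Real.rpow_mul_natCast hγ]; norm_num
  · rw [← Real.rpow_mul_natCast hγ]; norm_num

theorem rpow_quarter {t : ℝ} (ht : 0 ≤ t) : t = (t ^ (1 / 4 : ℝ)) ^ 4 ∧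
    t ^ (1 / 2 : ℝ) = (t ^ (1 / 4 : ℝ)) ^ 2 ∧ t ^ (3 / 4 : ℝ) = (t ^ (1 / 4 : ℝ)) ^ 3 := by
  refine ⟨?_, ?_, ?_⟩
  · rw [← Real.rpow_mul_natCast ht]; norm_num
  · rw [← Real.rpow_mul_natCast ht]; norm_num
  · rw [← Real.rpow_mul_natCast ht]; norm_num

/-- The constant of the tuned bounds, where `g₀` is a positive lower bound of the information
gain of one point. -/
noncomputable def tunedConst (lam g₀ : ℝ) : ℝ :=
  regretConst lam * (4 + (1 / √g₀ + √(2 * (1 + 1 / g₀)) / √lam)) + 4 * (1 + 1 / g₀)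

theorem tunedConst_pos {lam g₀ : ℝ} (hlam : 0 < lam) (hg₀ : 0 < g₀) : 0 < tunedConst lam g₀ := by
  have := regretConst_pos hlam
  unfold tunedConst
  positivity

theorem beta_le_mul_sqrt {X : Type*} {k : X → X → ℝ} {lam B R δ g₀ γ : ℝ} {H : ℕ}
    (hlam : 0 < lam) (hB : 0 ≤ B) (hR : 0 ≤ R) (hL : 0 ≤ Real.log (1 / δ)) (hg₀ : 0 < g₀)
    (hγ : g₀ ≤ γ) (hγH : maxInfoGain k lam H ≤ γ) :
    beta k lam B R δ H ≤ (1 / √g₀ + √(2 * (1 + 1 / g₀)) / √lam) *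
      (1 + B + R * √(1 + Real.log (1 / δ))) * √γ := by
  set L := Real.log (1 / δ) with hLdef
  have hγ0 : 0 < γ := by linarith
  have hs0 : 0 < √g₀ := Real.sqrt_pos.2 hg₀
  have hsl : 0 < √lam := Real.sqrt_pos.2 hlam
  have h1 : √(2 * maxInfoGain k lam H + 2 * L) ≤ √(2 * (1 + 1 / g₀)) * √(1 + L) * √γ := by
    rw [← Real.sqrt_mul (by positivity), ← Real.sqrt_mul (by positivity)]
    apply Real.sqrt_le_sqrt
    have h2 : 1 ≤ γ / g₀ := by rwa [one_le_div hg₀]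
    have h3 : 2 * (1 + 1 / g₀) * (1 + L) * γ = 2 * (1 + L) * γ + 2 * (1 + L) * (γ / g₀) := by
      field_simp
    rw [h3]
    nlinarith
  have h4 : 1 ≤ 1 / √g₀ * √γ := by
    rw [one_div_mul_eq_div, one_le_div hs0]
    exact Real.sqrt_le_sqrt hγ
  set c := √(2 * (1 + 1 / g₀)) with hc
  set V := R * √(1 + L) with hV
  have hV0 : 0 ≤ V := by positivity
  calc beta k lam B R δ H = B * 1 + 1 / √lam * R * √(2 * maxInfoGain k lam H + 2 * L) := by
        rw [beta, mul_one]
    _ ≤ B * (1 / √g₀ * √γ) + 1 / √lam * R * (c * √(1 + L) * √γ) := by gcongr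
    _ = (1 / √g₀ * B + c / √lam * V) * √γ := by rw [hV]; ring
    _ ≤ ((1 / √g₀ + c / √lam) * (1 + B + V)) * √γ := by
        gcongr
        have h5 : 0 ≤ 1 / √g₀ * (1 + V) + c / √lam * (1 + B) := by positivity
        linarith

variable {X E Ω : Type*} [NormedAddCommGroup E] [InnerProductSpace ℝ E] [CompleteSpace E]
  [RKHS ℝ E X ℝ] [MeasurableSpace X]
  {mΩ : MeasurableSpace Ω} {μ : Measure Ω} {f : ℕ → E} {x : ℕ → Ω → X}
  {η : ℕ → Ω → ℝ} {lam B R P δ : ℝ} {H T : ℕ}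

/-- For the zero kernel all functions vanish, and so does the regret. -/
theorem IsRun.le_measureReal_of_kern_eq_zero [Nonempty X] [IsProbabilityMeasure μ]
    (hk0 : ∀ z : X, kern E z z = 0) (hδ : 0 < δ) (h : IsRun E μ f x η lam B R P δ H T) {c : ℝ}
    (hc : 0 ≤ c) : 1 - δ ≤ μ.real {ω | dynRegret f (fun s => x s ω) T ≤ c} := by
  refine one_sub_le_measureReal_of_forall hδ fun ω => ?_
  have hz : ∀ z : X, ‖feature E z‖ ≤ 0 := by
    intro z
    have := hk0 z
    rw [kern_eq_inner, real_inner_self_eq_norm_sq] at this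
    exact (sq_eq_zero_iff.1 this).le
  have := dynRegret_le_of_norm_feature_le h.norm_le hz (fun s => x s ω)
  linarith

variable [TopologicalSpace X] [SecondCountableTopology X] [BorelSpace X]

/-- The regret bound for the reset interval `γ_T^{1/4} (T / q)^{1/2}`. The choices
`(q, W) = (1 + P, (1 + P)^{1/4})` and `(q, W) = (1, 1 + P)` are the two cases of interest. -/
theorem IsRun.le_measureReal_regret_tuned [Nonempty X] [IsProbabilityMeasure μ]
    (hk : Continuous fun p : X × X => kern E p.1 p.2) (hk1 : ∀ z : X, kern E z z ≤ 1)
    (hlam : 0 < lam) (hR : 0 ≤ R) (hδ : 0 < δ) (hδ1 : δ < 1) (hT : 1 ≤ T) {g₀ q W : ℝ}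
    (hg₀ : 0 < g₀) (hγ : g₀ ≤ maxInfoGain (kern E) lam T) (hq : 1 ≤ q)
    (hW : q ^ (1 / 4 : ℝ) ≤ W) (hPW : P ≤ W * q ^ (3 / 4 : ℝ))
    (hH : H = max 1 (min T
      ⌈maxInfoGain (kern E) lam T ^ (1 / 4 : ℝ) * ((T : ℝ) / q) ^ (1 / 2 : ℝ)⌉₊))
    (h : IsRun E μ f x η lam B R P δ H T) :
    1 - δ ≤ μ.real {ω | dynRegret f (fun s => x s ω) T ≤
      tunedConst lam g₀ * (1 + B + R * √(1 + Real.log (1 / δ))) *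
        (maxInfoGain (kern E) lam T ^ (7 / 8 : ℝ) * W * (T : ℝ) ^ (3 / 4 : ℝ))} := by
  have hki : ∀ x y : X, kern E x y = inner ℝ (feature E x) (feature E y) := kern_eq_inner
  have hB : 0 ≤ B := (norm_nonneg _).trans (h.norm_le 0 hT)
  have hP : 0 ≤ P := le_trans (Finset.sum_nonneg fun _ _ => norm_nonneg _) h.variation_le
  have hL : 0 ≤ Real.log (1 / δ) := Real.log_nonneg (by rw [le_div_iff₀ hδ]; linarith)
  set γ := maxInfoGain (kern E) lam T with hγdef
  have hγ0 : 0 < γ := by linarith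
  have hT0 : (0 : ℝ) < T := by exact_mod_cast hT
  have hq0 : 0 < q := by linarith
  obtain ⟨e1, e2, e3, e4⟩ := rpow_eighth hγ0.le
  obtain ⟨e5, e6, e7⟩ := rpow_quarter hT0.le
  obtain ⟨e8, e9, e10⟩ := rpow_quarter hq0.le
  set a := γ ^ (1 / 8 : ℝ) with ha
  set τ := (T : ℝ) ^ (1 / 4 : ℝ) with hτ
  set κ := q ^ (1 / 4 : ℝ) with hκ
  have ha0 : 0 < a := Real.rpow_pos_of_pos hγ0 _
  have hτ0 : 0 < τ := Real.rpow_pos_of_pos hT0 _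
  have hκ1 : 1 ≤ κ := Real.one_le_rpow hq (by norm_num)
  have hH' : H = max 1 (min T ⌈(a * τ / κ) ^ 2⌉₊) := by
    have h1 : γ ^ (1 / 4 : ℝ) * ((T : ℝ) / q) ^ (1 / 2 : ℝ) = (a * τ / κ) ^ 2 := by
      rw [Real.div_rpow hT0.le hq0.le, e4, e6, e9]; ring
    rw [hH, h1]
  rw [e10] at hPW
  rw [e3, e7]
  set Gd := 1 + B + R * √(1 + Real.log (1 / δ)) with hGd
  have hGd1 : 1 ≤ Gd := by
    have : 0 ≤ R * √(1 + Real.log (1 / δ)) := by positivity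
    linarith
  have hBG : B ≤ Gd := by
    have : 0 ≤ R * √(1 + Real.log (1 / δ)) := by positivity
    linarith
  set S := a ^ 7 * W * τ ^ 3 with hS
  have hS0 : 0 < S := by
    have : 0 < W := by linarith
    positivity
  set Cb := 1 / √g₀ + √(2 * (1 + 1 / g₀)) / √lam with hCb
  have hCb0 : 0 ≤ Cb := by positivity
  have hC1 := regretConst_pos hlam
  have hg0' : 0 < 1 / g₀ := by positivity
  rcases tuning_dichotomy ha0 hτ0 hκ1 hg₀ (e1 ▸ hγ) e5 hW hPW hP hH' with hA | ⟨hB1, hB2⟩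
  · refine one_sub_le_measureReal_of_forall hδ fun ω => ?_
    refine (dynRegret_le_of_norm_feature_le h.norm_le
      (fun z => norm_feature_le_one hki hk1 z) _).trans ?_
    calc 2 * B * 1 * T ≤ 2 * Gd * 1 * (2 * (1 + 1 / g₀) * S) := by gcongr
      _ = 4 * (1 + 1 / g₀) * Gd * S := by ring
      _ ≤ tunedConst lam g₀ * Gd * S := by
          have : 4 * (1 + 1 / g₀) ≤ tunedConst lam g₀ := by
            have : 0 ≤ regretConst lam * (4 + Cb) := by positivity
            unfold tunedConst
            linarith
          gcongr
  · have hH1 : 1 ≤ H := by rw [hH']; exact le_max_left _ _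
    have hHT : H ≤ T := by rw [hH']; exact max_le hT (min_le_left _ _)
    have hγH : maxInfoGain (kern E) lam H ≤ γ := maxInfoGain_mono hki hlam hk1 hHT
    refine (h.le_measureReal_regret hk hk1 hlam hR hδ hδ1 hH1 hHT).trans
      (measureReal_mono fun ω hω => ?_)
    rw [Set.mem_ofPred_eq] at hω ⊢
    refine hω.trans ?_
    have hβ := beta_le_mul_sqrt (B := B) hlam hB hR hL hg₀ hγ hγH
    rw [← hCb, ← hGd, e2] at hβ
    have hsγ : √(maxInfoGain (kern E) lam H) ≤ a ^ 4 := by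
      rw [← e2]; exact Real.sqrt_le_sqrt hγH
    have t1 : √(maxInfoGain (kern E) lam H) * (H : ℝ) ^ (3 / 2 : ℝ) * P ≤ 4 * S := by
      rw [rpow_three_halves]
      exact le_trans (by gcongr) hB1
    have t2 : beta (kern E) lam B R δ H * T * √(maxInfoGain (kern E) lam H / H) ≤ Cb * Gd * S := by
      rw [Real.sqrt_div' _ (by positivity)]
      calc beta (kern E) lam B R δ H * T * (√(maxInfoGain (kern E) lam H) / √H)
          ≤ Cb * Gd * a ^ 4 * T * (a ^ 4 / √H) := by gcongr
        _ = Cb * Gd * (a ^ 4 * (T * (a ^ 4 / √H))) := by ring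
        _ ≤ Cb * Gd * S := by gcongr
    calc _ ≤ regretConst lam * (4 * S + Cb * Gd * S) := by gcongr
      _ ≤ regretConst lam * (4 * (Gd * S) + Cb * Gd * S) := by
          gcongr
          exact le_mul_of_one_le_left hS0.le hGd1
      _ = regretConst lam * (4 + Cb) * Gd * S := by ring
      _ ≤ tunedConst lam g₀ * Gd * S := by
          have : regretConst lam * (4 + Cb) ≤ tunedConst lam g₀ := by
            unfold tunedConst
            have : 0 ≤ 4 * (1 + 1 / g₀) := by positivity
            linarith
          gcongr

end Tuning

end TVBO

theorem theorem1 (lam : ℝ) (hlam : 0 < lam) :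
    -- the regret bound for every reset interval, with a constant that depends only on `lam`
    (∃ C : ℝ, 0 < C ∧
      ∀ (d : ℕ) (X : Set (EuclideanSpace ℝ (Fin d))), IsCompact X →
      ∀ (E : Type*) [NormedAddCommGroup E] [InnerProductSpace ℝ E] [CompleteSpace E]
        [RKHS ℝ E X ℝ],
      Continuous (fun p : X × X => TVBO.kern E p.1 p.2) → (∀ z : X, TVBO.kern E z z ≤ 1) →
      ∀ (Ω : Type*) [MeasurableSpace Ω] (μ : Measure Ω) [IsProbabilityMeasure μ]
        (f : ℕ → E) (x : ℕ → Ω → X) (η : ℕ → Ω → ℝ) (B R P δ : ℝ) (H T : ℕ),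
      0 ≤ R → 0 < δ → δ < 1 → 1 ≤ H → H ≤ T →
      TVBO.IsRun E μ f x η lam B R P δ H T →
      1 - δ ≤ μ.real {ω | TVBO.dynRegret f (fun s => x s ω) T ≤
        C * (√(TVBO.maxInfoGain (TVBO.kern E) lam H) * (H : ℝ) ^ (3 / 2 : ℝ) * P
          + TVBO.beta (TVBO.kern E) lam B R δ H * T *
              √(TVBO.maxInfoGain (TVBO.kern E) lam H / H))}) ∧
    -- the tuned bounds, with constants that depend only on `lam` and the kernel
    (∀ (d : ℕ) (X : Set (EuclideanSpace ℝ (Fin d))), IsCompact X →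
      ∀ (E : Type*) [NormedAddCommGroup E] [InnerProductSpace ℝ E] [CompleteSpace E]
        [RKHS ℝ E X ℝ],
      Continuous (fun p : X × X => TVBO.kern E p.1 p.2) → (∀ z : X, TVBO.kern E z z ≤ 1) →
      ∃ C : ℝ, 0 < C ∧
      ∀ (Ω : Type*) [MeasurableSpace Ω] (μ : Measure Ω) [IsProbabilityMeasure μ]
        (f : ℕ → E) (x : ℕ → Ω → X) (η : ℕ → Ω → ℝ) (B R P δ : ℝ) (T : ℕ),
      0 ≤ R → 0 < δ → δ < 1 → 1 ≤ T →
      (TVBO.IsRun E μ f x η lam B R P δ (TVBO.resetKnown (TVBO.kern E) lam P T) T →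
        1 - δ ≤ μ.real {ω | TVBO.dynRegret f (fun s => x s ω) T ≤
          C * (1 + B + R * √(1 + Real.log (1 / δ))) *
            (TVBO.maxInfoGain (TVBO.kern E) lam T ^ (7 / 8 : ℝ) * (1 + P) ^ (1 / 4 : ℝ) *
              (T : ℝ) ^ (3 / 4 : ℝ))}) ∧
      (TVBO.IsRun E μ f x η lam B R P δ (TVBO.resetUnknown (TVBO.kern E) lam T) T →
        1 - δ ≤ μ.real {ω | TVBO.dynRegret f (fun s => x s ω) T ≤
          C * (1 + B + R * √(1 + Real.log (1 / δ))) *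
            (TVBO.maxInfoGain (TVBO.kern E) lam T ^ (7 / 8 : ℝ) * (1 + P) *
              (T : ℝ) ^ (3 / 4 : ℝ))})) := by
  refine ⟨⟨TVBO.regretConst lam, TVBO.regretConst_pos hlam, ?_⟩, ?_⟩
  · intro d X _ E _ _ _ _ hk hk1 Ω _ μ _ f x η B R P δ H T hR hδ hδ1 hH hHT h
    obtain ⟨ω₀⟩ : Nonempty Ω := nonempty_of_isProbabilityMeasure μ
    have : Nonempty X := ⟨x 0 ω₀⟩
    exact h.le_measureReal_regret hk hk1 hlam hR hδ hδ1 hH hHT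
  · intro d X _ E _ _ _ _ hk hk1
    by_cases hzero : ∀ z : X, TVBO.kern E z z = 0
    · refine ⟨1, one_pos, ?_⟩
      intro Ω _ μ _ f x η B R P δ T hR hδ hδ1 hT
      obtain ⟨ω₀⟩ : Nonempty Ω := nonempty_of_isProbabilityMeasure μ
      have : Nonempty X := ⟨x 0 ω₀⟩
      have hγ0 := TVBO.maxInfoGain_nonneg (TVBO.kern_eq_inner (E := E) (X := X)) hlam T
      constructor <;> intro h <;>
      · have hB : 0 ≤ B := (norm_nonneg _).trans (h.norm_le 0 hT)
        have hP : 0 ≤ P := le_trans (Finset.sum_nonneg fun _ _ => norm_nonneg _) h.variation_le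
        exact h.le_measureReal_of_kern_eq_zero hzero hδ (by positivity)
    · push Not at hzero
      obtain ⟨z₀, hz₀⟩ := hzero
      have hpos : 0 < TVBO.kern E z₀ z₀ := by
        refine lt_of_le_of_ne ?_ hz₀.symm
        rw [TVBO.kern_eq_inner]
        exact real_inner_self_nonneg
      set g₀ := (1 / 2 : ℝ) * Real.log (1 + TVBO.kern E z₀ z₀ / lam) with hg₀
      have hg₀pos : 0 < g₀ := by
        have h1 : 0 < TVBO.kern E z₀ z₀ / lam := by positivity
        have := Real.log_pos (show 1 < 1 + TVBO.kern E z₀ z₀ / lam by linarith)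
        positivity
      refine ⟨TVBO.tunedConst lam g₀, TVBO.tunedConst_pos hlam hg₀pos, ?_⟩
      intro Ω _ μ _ f x η B R P δ T hR hδ hδ1 hT
      have : Nonempty X := ⟨z₀⟩
      have hγ : g₀ ≤ TVBO.maxInfoGain (TVBO.kern E) lam T := by
        refine le_trans ?_ (TVBO.log_one_add_mul_kern_le_maxInfoGain
          (TVBO.kern_eq_inner (E := E) (X := X)) hlam hk1 T z₀)
        have hT1 : (1 : ℝ) ≤ T := by exact_mod_cast hT
        have h1 : 0 < TVBO.kern E z₀ z₀ / lam := by positivity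
        rw [hg₀]
        gcongr
        exact le_mul_of_one_le_left h1.le hT1
      constructor <;> intro h
      · have hP : 0 ≤ P := le_trans (Finset.sum_nonneg fun _ _ => norm_nonneg _) h.variation_le
        refine h.le_measureReal_regret_tuned hk hk1 hlam hR hδ hδ1 hT hg₀pos hγ
          (q := 1 + P) (by linarith) le_rfl ?_ rfl
        rw [← Real.rpow_add (by linarith)]
        norm_num
      · have hP : 0 ≤ P := le_trans (Finset.sum_nonneg fun _ _ => norm_nonneg _) h.variation_le
        refine h.le_measureReal_regret_tuned hk hk1 hlam hR hδ hδ1 hT hg₀pos hγ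
          (q := 1) le_rfl (by simpa using hP) (by simp) ?_
        rw [TVBO.resetUnknown, div_one]
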